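/- Let $M$ be a smooth manifold of dimension $n$ (Hausdorff, second countable) with a pseudo-Riemannian metric, i.e. a smoothly varying family $\langle\,,\,\rangle_x$ of nondegenerate symmetric bilinear forms on the tangent spaces $T_x(M)$. For an open set $U\subseteq M$, let $C^{-\infty}(U)$ be the space of generalized functions on $U$, i.e. continuous linear functionals on the space of compactly supported smooth (complex) densities on $U$ with its inductive limit topology; differential operators on $M$ with smooth complex coefficients act on $C^{-\infty}(U)$ by extending (by duality) their action on smooth functions. Let $Z$ be a (locally closed) submanifold of $M$ that is metrically proper: for every $z\in Z$ the tangent space $T_z(Z)$ is contained in a proper subspace of $T_z(M)$ on which $\langle\,,\,\rangle_z$ is nondegenerate. Let $D$ be a differential operator on $M$ of order at most $2$ and of Laplacian type: for every $x\in M$ its principal symbol, as an element of $S^2(T_x(M)\otimes_{\mathbb R}\mathbb C)$, is $$\sigma_2(D)(x)=u_1v_1+u_2v_2+\cdots+u_nv_n,$$ where $u_1,\dots,u_n$ is a basis of $T_x(M)$ and $v_1,\dots,v_n$ is the dual basis of $T_x(M)$ with respect to $\langle\,,\,\rangle_x$. Let $U$ be an open subset of $M$ that contains $Z$ as a closed subset.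 If $f\in C^{-\infty}(U)$ has support contained in $Z$ and $Df=0$ on $U$, then $f=0$. -/

import Mathlib

open scoped Manifold ContDiff Topology TensorProduct Distributions
open TopologicalSpace MeasureTheory

namespace GenFun

/-! ### Calculus on open subsets of a vector space -/

section Calculus

variable {E : Type*} [NormedAddCommGroup E] [NormedSpace ℝ E]

theorem contDiff_indicator {O K : Set E} (hO : IsOpen O) (hK : IsClosed K) (hKO : K ⊆ O)
    {g : E → ℂ} (hg : ContDiffOn ℝ ∞ g O) (h0 : ∀ y ∈ O, y ∉ K → g y = 0) :
    ContDiff ℝ ∞ (O.indicator g) := by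
  rw [contDiff_iff_contDiffAt]
  intro y
  by_cases hy : y ∈ O
  · refine (hg.contDiffAt (hO.mem_nhds hy)).congr_of_eventuallyEq ?_
    filter_upwards [hO.mem_nhds hy] with z hz
    simp [hz]
  · have : O.indicator g =ᶠ[𝓝 y] fun _ => 0 := by
      filter_upwards [hK.isOpen_compl.mem_nhds (fun h => hy (hKO h))] with z hz
      by_cases hzO : z ∈ O
      · simp [hzO, h0 z hzO hz]
      · simp [hzO]
    exact contDiffAt_const.congr_of_eventuallyEq this

variable [MeasurableSpace E] [BorelSpace E] {μ : Measure E} [IsLocallyFiniteMeasure μ]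

theorem integrableOn_of_zero_off {O K : Set E} (hO : IsOpen O) (hK : IsCompact K) (hKO : K ⊆ O)
    {g : E → ℂ} (hg : ContinuousOn g O) (h0 : ∀ y ∈ O, y ∉ K → g y = 0) :
    IntegrableOn g O μ :=
  ((hg.mono hKO).integrableOn_compact hK).of_forall_sdiff_eq_zero hO.measurableSet
    fun y hy => h0 y hy.1 hy.2

variable [FiniteDimensional ℝ E] [μ.IsAddHaarMeasure]

theorem integral_mul_fderiv {O : Set E} (hO : IsOpen O) {w : E → ℂ} (hw : ContDiffOn ℝ ∞ w O)
    {g : E → ℂ} (hg : ContDiff ℝ ∞ g) (hc : HasCompactSupport g) (hs : tsupport g ⊆ O) (v : E) :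
    ∫ y in O, w y * fderiv ℝ g y v ∂μ = ∫ y in O, -(fderiv ℝ w y v) * g y ∂μ := by
  have hdw : ContDiffOn ℝ ∞ (fun y => fderiv ℝ w y v) O :=
    (hw.fderiv_of_isOpen hO (by simp)).clm_apply contDiffOn_const
  have hdg : ContDiff ℝ ∞ (fun y => fderiv ℝ g y v) :=
    (hg.fderiv_right (by simp)).clm_apply contDiff_const
  have hg0 : ∀ y ∈ O, y ∉ tsupport g → g y = 0 := fun y _ hy => image_eq_zero_of_notMem_tsupport hy
  have hdg0 : ∀ y ∈ O, y ∉ tsupport g → fderiv ℝ g y v = 0 := fun y _ hy => by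
    rw [image_eq_zero_of_notMem_tsupport (fun h => hy (tsupport_fderiv_subset ℝ h))]; rfl
  have i1 : IntegrableOn (fun y => w y * fderiv ℝ g y v) O μ :=
    integrableOn_of_zero_off hO hc hs (hw.continuousOn.mul hdg.continuous.continuousOn)
      fun y h h' => by simp [hdg0 y h h']
  have i2 : IntegrableOn (fun y => fderiv ℝ w y v * g y) O μ :=
    integrableOn_of_zero_off hO hc hs (hdw.continuousOn.mul hg.continuous.continuousOn)
      fun y h h' => by simp [hg0 y h h']
  set p : E → ℂ := O.indicator (fun y => w y * g y) with hp
  have hpc : ContDiff ℝ ∞ p := contDiff_indicator hO (isClosed_tsupport g) hs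
    (hw.mul hg.contDiffOn) fun y h h' => by simp [hg0 y h h']
  have hpsub : Function.support p ⊆ tsupport g := by
    intro y hy
    by_contra h
    exact hy (by simp [hp, Set.indicator, image_eq_zero_of_notMem_tsupport h])
  have hps : HasCompactSupport p := hc.mono' hpsub
  have hdp : Continuous fun y => fderiv ℝ p y v :=
    (hpc.continuous_fderiv (by simp)).clm_apply continuous_const
  have hdps : HasCompactSupport fun y => fderiv ℝ p y v := hps.fderiv_apply ℝ v
  have key : ∫ y, fderiv ℝ p y v ∂μ = 0 := by
    have := integral_mul_fderiv_eq_neg_fderiv_mul_of_integrable (μ := μ) (v := v)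
      (f := fun _ : E => (1 : ℂ)) (g := p) (by simp)
      (by simpa using hdp.integrable_of_hasCompactSupport hdps)
      (by simpa using hpc.continuous.integrable_of_hasCompactSupport hps)
      (fun y _ => differentiableAt_const _) (fun y _ => hpc.differentiable (by simp) y)
    simpa using this
  have hO1 : ∫ y in O, fderiv ℝ p y v ∂μ = 0 := by
    rw [← key]
    refine setIntegral_eq_integral_of_forall_compl_eq_zero fun y hy => ?_
    have : y ∉ tsupport p := fun h => hy (hs (closure_minimal hpsub (isClosed_tsupport g) h))
    rw [image_eq_zero_of_notMem_tsupport (fun h => this (tsupport_fderiv_subset ℝ h))]; rfl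
  have hO2 : ∫ y in O, fderiv ℝ p y v ∂μ
      = ∫ y in O, (w y * fderiv ℝ g y v + fderiv ℝ w y v * g y) ∂μ := by
    refine setIntegral_congr_fun hO.measurableSet fun y hy => ?_
    have e1 : p =ᶠ[𝓝 y] fun y => w y * g y := by
      filter_upwards [hO.mem_nhds hy] with z hz
      simp [hp, hz]
    rw [e1.fderiv_eq, fderiv_fun_mul ((hw.contDiffAt (hO.mem_nhds hy)).differentiableAt (by simp))
      (hg.differentiable (by simp) y)]
    simp [mul_comm]
  rw [hO1, integral_add i1 i2] at hO2
  simp only [neg_mul, integral_neg]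
  linear_combination -hO2

theorem exists_integral_mul_iteratedFDeriv {O : Set E} (hO : IsOpen O) (j : ℕ) :
    ∀ (v : Fin j → E) {w : E → ℂ}, ContDiffOn ℝ ∞ w O → ∃ w' : E → ℂ, ContDiffOn ℝ ∞ w' O ∧
      ∀ g : E → ℂ, ContDiff ℝ ∞ g → HasCompactSupport g → tsupport g ⊆ O →
        ∫ y in O, w y * iteratedFDeriv ℝ j g y v ∂μ = ∫ y in O, w' y * g y ∂μ := by
  induction j with
  | zero => exact fun v w hw => ⟨w, hw, fun g _ _ _ => by simp⟩
  | succ j ih =>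
    intro v w hw
    obtain ⟨w', hw', H⟩ := ih (Fin.tail v) (w := fun y => -(fderiv ℝ w y (v 0)))
      (((hw.fderiv_of_isOpen hO (by simp)).clm_apply contDiffOn_const).neg)
    refine ⟨w', hw', fun g hg hc hs => ?_⟩
    rw [← H g hg hc hs]
    have hsm : ContDiff ℝ ∞ (fun y => iteratedFDeriv ℝ j g y) :=
      hg.iteratedFDeriv_right (by exact_mod_cast le_top)
    have hsm' : ContDiff ℝ ∞ (fun y => iteratedFDeriv ℝ j g y (Fin.tail v)) :=
      (ContinuousMultilinearMap.apply ℝ (fun _ : Fin j => E) ℂ (Fin.tail v)).contDiff.comp hsm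
    have hsub : Function.support (fun y => iteratedFDeriv ℝ j g y (Fin.tail v)) ⊆ tsupport g := by
      intro y hy
      refine support_iteratedFDeriv_subset (𝕜 := ℝ) (n := j) fun h => hy ?_
      simp only [h]; rfl
    rw [← integral_mul_fderiv hO hw hsm' (hc.mono' hsub)
      ((closure_minimal hsub (isClosed_tsupport g)).trans hs) (v 0)]
    refine integral_congr_ae (Filter.Eventually.of_forall fun y => ?_)
    simp only
    rw [iteratedFDeriv_succ_apply_left]
    congr 1
    have hd : DifferentiableAt ℝ (iteratedFDeriv ℝ j g) y := hsm.differentiable (by simp) y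
    have := ((ContinuousMultilinearMap.apply ℝ (fun _ : Fin j => E) ℂ
      (Fin.tail v)).hasFDerivAt.comp y hd.hasFDerivAt).fderiv
    exact (DFunLike.congr_fun this (v 0)).symm

end Calculus

/-! ### Smooth functions, densities and generalized functions -/

section Manifold

variable (n : ℕ) (M : Type*) [TopologicalSpace M] [ChartedSpace (EuclideanSpace ℝ (Fin n)) M]

/-- The space `C^∞(M)` of complex valued smooth functions. -/
def SmoothFn : Submodule ℂ (M → ℂ) where
  carrier := {h | ContMDiff (𝓡 n) 𝓘(ℝ, ℂ) ∞ h}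
  add_mem' ha hb := ha.add hb
  zero_mem' := contMDiff_const
  smul_mem' c _ ha := ((c • ContinuousLinearMap.id ℝ ℂ).contMDiff).comp ha

/-- The local coordinate systems of `M`. -/
abbrev Charts : Set (OpenPartialHomeomorph M (EuclideanSpace ℝ (Fin n))) :=
  IsManifold.maximalAtlas (𝓡 n) ∞ M

variable {n M}

theorem contDiffOn_comp_symm (h : SmoothFn n M) {e} (he : e ∈ Charts n M) :
    ContDiffOn ℝ ∞ (fun y => h.1 (e.symm y)) e.target :=
  contMDiffOn_iff_contDiffOn.1
    (ContMDiff.comp_contMDiffOn h.2 (contMDiffOn_symm_of_mem_maximalAtlas he))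

theorem comp_symm_eq_zero (h : SmoothFn n M)
    {e : OpenPartialHomeomorph M (EuclideanSpace ℝ (Fin n))} :
    ∀ y ∈ e.target, y ∉ e '' tsupport h.1 → h.1 (e.symm y) = 0 := fun y hy hy' =>
  image_eq_zero_of_notMem_tsupport fun h' => hy' ⟨_, h', e.right_inv hy⟩

theorem isCompact_image_tsupport {h : SmoothFn n M} (hc : HasCompactSupport h.1)
    {e : OpenPartialHomeomorph M (EuclideanSpace ℝ (Fin n))} (hs : tsupport h.1 ⊆ e.source) :
    IsCompact (e '' tsupport h.1) ∧ e '' tsupport h.1 ⊆ e.target :=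
  ⟨hc.isCompact.image_of_continuousOn (e.continuousOn.mono hs),
    (Set.image_mono hs).trans e.image_source_eq_target.subset⟩

theorem integrableOn_mul {e} (he : e ∈ Charts n M) {w : EuclideanSpace ℝ (Fin n) → ℂ}
    (hw : ContinuousOn w e.target) {h : SmoothFn n M} (hc : HasCompactSupport h.1)
    (hs : tsupport h.1 ⊆ e.source) :
    IntegrableOn (fun y => w y * h.1 (e.symm y)) e.target :=
  integrableOn_of_zero_off e.open_target (isCompact_image_tsupport hc hs).1
    (isCompact_image_tsupport hc hs).2 (hw.mul (contDiffOn_comp_symm h he).continuousOn)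
    fun y hy hy' => by simp [comp_symm_eq_zero h y hy hy']

/-- The space `D_0^∞(U)` of smooth densities on `M` with compact support contained in the open set
`U`. A compactly supported distribution is a linear form on `C^∞(M)` (whose value on a function
only depends on the function near a compact set), and it is a smooth density if in all local
coordinates it is a smooth function times Lebesgue measure. -/
def Density (U : Opens M) : Submodule ℂ (SmoothFn n M →ₗ[ℂ] ℂ) where
  carrier := {ρ |
    (∃ K : Set M, IsCompact K ∧ K ⊆ U ∧
      ∀ h : SmoothFn n M, (∀ᶠ x in 𝓝ˢ K, h.1 x = 0) → ρ h = 0) ∧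
    ∀ e ∈ Charts n M, ∃ w : EuclideanSpace ℝ (Fin n) → ℂ, ContDiffOn ℝ ∞ w e.target ∧
      ∀ h : SmoothFn n M, HasCompactSupport h.1 → tsupport h.1 ⊆ e.source →
        ρ h = ∫ y in e.target, w y * h.1 (e.symm y)}
  add_mem' := by
    rintro ρ τ ⟨⟨K, hK, hKU, h0⟩, hw⟩ ⟨⟨K', hK', hKU', h0'⟩, hw'⟩
    refine ⟨⟨K ∪ K', hK.union hK', Set.union_subset hKU hKU', fun h hh => ?_⟩, fun e he => ?_⟩
    · rw [nhdsSet_union, Filter.eventually_sup] at hh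
      simp [h0 h hh.1, h0' h hh.2]
    · obtain ⟨w, hwc, hw⟩ := hw e he
      obtain ⟨w', hwc', hw'⟩ := hw' e he
      refine ⟨fun y => w y + w' y, hwc.add hwc', fun h hc hs => ?_⟩
      simp only [LinearMap.add_apply, hw h hc hs, hw' h hc hs, add_mul]
      exact (integral_add (integrableOn_mul he hwc.continuousOn hc hs)
        (integrableOn_mul he hwc'.continuousOn hc hs)).symm
  zero_mem' := ⟨⟨∅, isCompact_empty, Set.empty_subset _, fun _ _ => rfl⟩,
    fun _ _ => ⟨0, contDiffOn_const, fun h _ _ => by simp⟩⟩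
  smul_mem' := by
    rintro c ρ ⟨⟨K, hK, hKU, h0⟩, hw⟩
    refine ⟨⟨K, hK, hKU, fun h hh => by simp [h0 h hh]⟩, fun e he => ?_⟩
    obtain ⟨w, hwc, hw⟩ := hw e he
    refine ⟨fun y => c * w y, contDiffOn_const.mul hwc, fun h hc hs => ?_⟩
    simp only [LinearMap.smul_apply, hw h hc hs, smul_eq_mul, mul_assoc]
    exact (integral_const_mul _ _).symm

/-- The part of the coordinate domain of `e` that corresponds to `U`. -/
def chartDomain (e : OpenPartialHomeomorph M (EuclideanSpace ℝ (Fin n))) (U : Opens M) :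
    Opens (EuclideanSpace ℝ (Fin n)) :=
  ⟨e.target ∩ e.symm ⁻¹' U, e.isOpen_inter_preimage_symm U.isOpen⟩

theorem integrableOn_testFunction_mul {e} (he : e ∈ Charts n M) {U : Opens M}
    (φ : 𝓓(chartDomain e U, ℂ)) (h : SmoothFn n M) :
    IntegrableOn (fun y => φ y * h.1 (e.symm y)) e.target :=
  integrableOn_of_zero_off e.open_target φ.hasCompactSupport.isCompact
    (φ.tsupport_subset.trans Set.inter_subset_left)
    (φ.continuous.continuousOn.mul (contDiffOn_comp_symm h he).continuousOn)
    fun y _ hy' => by simp [image_eq_zero_of_notMem_tsupport hy']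

/-- The linear form `h ↦ ∫ φ(y) h(e⁻¹(y)) dy` on `C^∞(M)`. -/
noncomputable def ofChartAux {e} (he : e ∈ Charts n M) {U : Opens M}
    (φ : 𝓓(chartDomain e U, ℂ)) : SmoothFn n M →ₗ[ℂ] ℂ where
  toFun h := ∫ y in e.target, φ y * h.1 (e.symm y)
  map_add' h h' := by
    rw [← integral_add (integrableOn_testFunction_mul he φ h)
      (integrableOn_testFunction_mul he φ h')]
    simp [mul_add]
  map_smul' c h := by
    simp only [RingHom.id_apply, smul_eq_mul, ← integral_const_mul]
    simp [mul_left_comm]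

theorem ofChartAux_mem [T2Space M] {e} (he : e ∈ Charts n M) {U : Opens M}
    (φ : 𝓓(chartDomain e U, ℂ)) : ofChartAux he φ ∈ Density (n := n) U := by
  have hsub : tsupport φ ⊆ e.target := φ.tsupport_subset.trans Set.inter_subset_left
  have hK : IsCompact (e.symm '' tsupport φ) :=
    φ.hasCompactSupport.isCompact.image_of_continuousOn (e.continuousOn_symm.mono hsub)
  have hKs : e.symm '' tsupport φ ⊆ e.source :=
    (Set.image_mono hsub).trans e.symm_image_target_eq_source.subset
  refine ⟨⟨e.symm '' tsupport φ, hK, ?_, fun h hh => ?_⟩, fun e' he' => ?_⟩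
  · rintro _ ⟨y, hy, rfl⟩
    exact (φ.tsupport_subset hy).2
  · refine (setIntegral_congr_fun (g := fun _ => (0 : ℂ)) e.open_target.measurableSet
      fun y _ => ?_).trans (by simp)
    by_cases hy : y ∈ tsupport φ
    · simp [hh.self_of_nhdsSet _ (Set.mem_image_of_mem _ hy)]
    · simp [image_eq_zero_of_notMem_tsupport hy]
  · set T := e'.symm.trans e with hT
    have hTs : ContDiffOn ℝ ∞ T T.source := by
      have := contMDiffOn_iff_contDiffOn.1 ((contMDiffOn_of_mem_maximalAtlas he).comp'
        (contMDiffOn_symm_of_mem_maximalAtlas he'))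
      refine this.mono ?_
      intro y hy
      simpa [hT] using hy
    have hTi : ContDiffOn ℝ ∞ T.symm T.target := by
      have := contMDiffOn_iff_contDiffOn.1 ((contMDiffOn_of_mem_maximalAtlas he').comp'
        (contMDiffOn_symm_of_mem_maximalAtlas he))
      refine this.mono ?_
      intro y hy
      simpa [hT, OpenPartialHomeomorph.trans_target] using hy
    have hdet : ∀ y ∈ T.source, (fderiv ℝ T y).det ≠ 0 := by
      intro y hy h0
      have h1 : HasFDerivAt T (fderiv ℝ T y) y :=
        ((hTs.contDiffAt (T.open_source.mem_nhds hy)).differentiableAt (by simp)).hasFDerivAt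
      have h2 : HasFDerivAt T.symm (fderiv ℝ T.symm (T y)) (T y) :=
        ((hTi.contDiffAt (T.open_target.mem_nhds (T.map_source hy))).differentiableAt
          (by simp)).hasFDerivAt
      have h3 : HasFDerivAt (T.symm ∘ T) (ContinuousLinearMap.id ℝ _) y := by
        refine (hasFDerivAt_id y).congr_of_eventuallyEq ?_
        filter_upwards [T.open_source.mem_nhds hy] with z hz
        simp [T.left_inv hz]
      have h4 := (h2.comp y h1).unique h3
      have h5 : LinearMap.det ((fderiv ℝ T.symm (T y)).toLinearMap ∘ₗ
          (fderiv ℝ T y).toLinearMap) = 1 :=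
        (congrArg (fun A : EuclideanSpace ℝ (Fin n) →L[ℝ] EuclideanSpace ℝ (Fin n) =>
          LinearMap.det A.toLinearMap) h4).trans LinearMap.det_id
      rw [LinearMap.det_comp, show LinearMap.det (fderiv ℝ T y).toLinearMap = 0 from h0] at h5
      simp at h5
    set w : EuclideanSpace ℝ (Fin n) → ℂ :=
      T.source.indicator fun y => ((|(fderiv ℝ T y).det| : ℝ) : ℂ) * φ (T y) with hw
    refine ⟨w, ?_, fun h hc hs => ?_⟩
    · intro y hy
      refine ContDiffAt.contDiffWithinAt ?_
      by_cases hyT : y ∈ T.source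
      · have e1 : w =ᶠ[𝓝 y] fun y => ((|(fderiv ℝ T y).det| : ℝ) : ℂ) * φ (T y) := by
          filter_upwards [T.open_source.mem_nhds hyT] with z hz
          simp [hw, hz]
        refine ContDiffAt.congr_of_eventuallyEq ?_ e1
        have hT1 := hTs.contDiffAt (T.open_source.mem_nhds hyT)
        have hd : ContDiffAt ℝ ∞ (fun y => (fderiv ℝ T y).det) y := by
          have : ContDiff ℝ ∞ fun A : EuclideanSpace ℝ (Fin n) →L[ℝ] EuclideanSpace ℝ (Fin n) =>
              A.det := by
            have hb := fun A : EuclideanSpace ℝ (Fin n) →L[ℝ] EuclideanSpace ℝ (Fin n) =>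
              (LinearMap.det_toMatrix (EuclideanSpace.basisFun (Fin n) ℝ).toBasis
                (A : EuclideanSpace ℝ (Fin n) →ₗ[ℝ] EuclideanSpace ℝ (Fin n)))
            simp only [ContinuousLinearMap.det, ← hb, Matrix.det_apply',
              LinearMap.toMatrix_apply]
            refine ContDiff.sum fun σ _ => contDiff_const.mul (contDiff_prod fun i _ => ?_)
            exact (((EuclideanSpace.basisFun (Fin n) ℝ).toBasis.coord (σ i)).toContinuousLinearMap ∘L
              ContinuousLinearMap.apply ℝ _
                ((EuclideanSpace.basisFun (Fin n) ℝ).toBasis i)).contDiff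
          exact this.contDiffAt.comp y (hT1.fderiv_right (by simp))
        exact (Complex.ofRealCLM.contDiff.contDiffAt.comp y (hd.abs (hdet y hyT))).mul
          (φ.contDiff.contDiffAt.comp y hT1)
      · have hne : e'.symm y ∉ e.symm '' tsupport φ := fun h' =>
          hyT (by simp [hT, hy, hKs h'])
        have : w =ᶠ[𝓝 y] fun _ => 0 := by
          have hcont := e'.continuousAt_symm hy
          filter_upwards [hcont.preimage_mem_nhds (hK.isClosed.isOpen_compl.mem_nhds hne)]
            with z hz
          by_cases hzT : z ∈ T.source
          · have hφ : φ (T z) = 0 := by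
              refine image_eq_zero_of_notMem_tsupport fun h' => hz ⟨_, h', ?_⟩
              have hz2 : e'.symm z ∈ e.source := by simpa [hT] using hzT.2
              simp [hT, e.left_inv hz2]
            simp [hw, hφ]
          · simp [hw, hzT]
        exact contDiffAt_const.congr_of_eventuallyEq this
    · have hTt : T.target ⊆ e.target := by
        intro y hy
        rw [hT, OpenPartialHomeomorph.trans_target] at hy
        exact hy.1
      have hTs' : T.source ⊆ e'.target := by
        intro y hy
        have := hy.1
        simpa using this
      have s1 : ∫ y in e.target, φ y * h.1 (e.symm y) = ∫ y in T.target, φ y * h.1 (e.symm y) := by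
        refine (setIntegral_eq_of_subset_of_forall_sdiff_eq_zero e.open_target.measurableSet hTt
          fun y hy => ?_)
        have : e.symm y ∉ tsupport h.1 := fun h' => hy.2 (by
          rw [hT, OpenPartialHomeomorph.trans_target]
          exact ⟨hy.1, by simpa using hs h'⟩)
        simp [image_eq_zero_of_notMem_tsupport this]
      have s2 : ∫ y in e'.target, w y * h.1 (e'.symm y) = ∫ y in T.source, w y * h.1 (e'.symm y) :=
        setIntegral_eq_of_subset_of_forall_sdiff_eq_zero e'.open_target.measurableSet hTs'
          fun y hy => by simp [hw, hy.2]
      change ∫ y in e.target, φ y * h.1 (e.symm y) = _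
      rw [s1, s2, ← T.image_source_eq_target,
        integral_image_eq_integral_abs_det_fderiv_smul volume T.open_source.measurableSet
          (f' := fderiv ℝ T) (fun y hy => ((hTs.contDiffAt
            (T.open_source.mem_nhds hy)).differentiableAt (by simp)).hasFDerivAt.hasFDerivWithinAt)
          T.injOn]
      refine setIntegral_congr_fun T.open_source.measurableSet fun y hy => ?_
      have hz2 : e'.symm y ∈ e.source := by simpa [hT] using hy.2
      have : e.symm (T y) = e'.symm y := by simp [hT, e.left_inv hz2]
      simp [hw, hy, this, mul_assoc]

/-- The smooth density on `U` given by a test function in a local coordinate system. -/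
noncomputable def ofChart [T2Space M] (U : Opens M) {e} (he : e ∈ Charts n M)
    (φ : 𝓓(chartDomain e U, ℂ)) : Density (n := n) U :=
  ⟨ofChartAux he φ, ofChartAux_mem he φ⟩

/-- The inductive smooth topology on `D_0^∞(U)`: the finest locally convex topology for which all
the inclusions of the spaces of test functions on coordinate domains (with their usual LF topology)
are continuous. -/
noncomputable instance Density.topologicalSpace [T2Space M] (U : Opens M) :
    TopologicalSpace (Density (n := n) U) :=
  sInf {t | (∀ e (he : e ∈ Charts n M), Continuous[_, t] (ofChart U he)) ∧
    @IsTopologicalAddGroup _ t _ ∧ @ContinuousSMul ℝ _ _ _ t ∧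
    @LocallyConvexSpace ℝ _ _ _ _ _ t}

/-- The space `C^{-∞}(U)` of generalized functions on the open subset `U` of `M`: the continuous
linear forms on the space of compactly supported smooth densities on `U`. -/
abbrev GeneralizedFunction [T2Space M] (U : Opens M) : Type _ :=
  Density (n := n) U →L[ℂ] ℂ

/-- The support of a generalized function on `U`: the points of `U` without a neighbourhood on
which the generalized function vanishes. -/
def support [T2Space M] {U : Opens M} (f : GeneralizedFunction (n := n) U) : Set M :=
  {x | x ∈ U ∧ ∀ V : Opens M, x ∈ V → V ≤ U →
    ∃ ρ : Density (n := n) U, ρ.1 ∈ Density (n := n) V ∧ f ρ ≠ 0}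

/-! ### Differential operators -/

/-- The functions `a j s`, for `s = (s_1, …, s_j)`, are coefficients of `D` in the coordinate
system `e`: `D = ∑_{j ≤ k} ∑_s (a j s) ∂_{s_1} ⋯ ∂_{s_j}`. -/
def IsLocalExpression (k : ℕ) (D : SmoothFn n M →ₗ[ℂ] SmoothFn n M)
    (e : OpenPartialHomeomorph M (EuclideanSpace ℝ (Fin n)))
    (a : (j : ℕ) → (Fin j → Fin n) → EuclideanSpace ℝ (Fin n) → ℂ) : Prop :=
  (∀ j s, ContDiffOn ℝ ∞ (a j s) e.target) ∧
  ∀ (h : SmoothFn n M), ∀ y ∈ e.target,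
    (D h).1 (e.symm y) = ∑ j ∈ Finset.range (k + 1), ∑ s : Fin j → Fin n,
      a j s y * iteratedFDeriv ℝ j (fun y => h.1 (e.symm y)) y
        (fun i => EuclideanSpace.single (s i) (1 : ℝ))

variable (n M) in
/-- The space `DO(M)_k` of differential operators with smooth complex coefficients, of order at
most `k`. -/
def DiffOp (k : ℕ) : Submodule ℂ (SmoothFn n M →ₗ[ℂ] SmoothFn n M) where
  carrier := {D | ∀ e ∈ Charts n M, ∃ a, IsLocalExpression k D e a}
  add_mem' := by
    intro D D' hD hD' e he
    obtain ⟨a, ha, h⟩ := hD e he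
    obtain ⟨a', ha', h'⟩ := hD' e he
    refine ⟨fun j s y => a j s y + a' j s y, fun j s => (ha j s).add (ha' j s),
      fun f y hy => ?_⟩
    simp only [add_mul, Finset.sum_add_distrib, ← h f y hy, ← h' f y hy]
    rfl
  zero_mem' := fun e _ => ⟨fun _ _ _ => 0, fun _ _ => contDiffOn_const, fun f y _ => by simp⟩
  smul_mem' := by
    intro c D hD e he
    obtain ⟨a, ha, h⟩ := hD e he
    refine ⟨fun j s y => c * a j s y, fun j s => contDiffOn_const.mul (ha j s),
      fun f y hy => ?_⟩
    simp only [mul_assoc, ← Finset.mul_sum, ← h f y hy]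
    rfl

theorem diffOp_eq_zero [IsManifold (𝓡 n) ∞ M] {k : ℕ} (D : DiffOp n M k)
    {h : SmoothFn n M} {x : M} (hx : ∀ᶠ z in 𝓝 x, h.1 z = 0) : (D.1 h).1 x = 0 := by
  set e := chartAt (EuclideanSpace ℝ (Fin n)) x with he
  have hxs : x ∈ e.source := mem_chart_source _ x
  obtain ⟨a, -, H⟩ := D.2 e (IsManifold.chart_mem_maximalAtlas x)
  have h1 := H h (e x) (e.map_source hxs)
  rw [e.left_inv hxs] at h1
  rw [h1]
  have h2 : (fun y => h.1 (e.symm y)) =ᶠ[𝓝 (e x)] fun _ => 0 := by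
    have hc := e.continuousAt_symm (e.map_source hxs)
    rw [ContinuousAt, e.left_inv hxs] at hc
    exact hc.eventually hx
  refine Finset.sum_eq_zero fun j _ => Finset.sum_eq_zero fun s _ => ?_
  rw [(h2.iteratedFDeriv ℝ j).eq_of_nhds]
  simp

theorem comp_diffOp_mem [IsManifold (𝓡 n) ∞ M] {k : ℕ} (D : DiffOp n M k) {U : Opens M}
    {ρ : SmoothFn n M →ₗ[ℂ] ℂ} (hρ : ρ ∈ Density U) : ρ ∘ₗ D.1 ∈ Density U := by
  obtain ⟨⟨K, hK, hKU, h0⟩, hw⟩ := hρ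
  refine ⟨⟨K, hK, hKU, fun h hh => h0 _ ?_⟩, fun e he => ?_⟩
  · rw [eventually_nhdsSet_iff_forall] at hh ⊢
    exact fun x hx => (hh x hx).eventually_nhds.mono fun z hz => diffOp_eq_zero D hz
  · obtain ⟨w, hwc, hw⟩ := hw e he
    obtain ⟨a, ha, H⟩ := D.2 e he
    choose w' hw'c hw' using fun (j : ℕ) (s : Fin j → Fin n) =>
      exists_integral_mul_iteratedFDeriv (μ := volume) e.open_target j
        (fun i => EuclideanSpace.single (s i) (1 : ℝ)) (hwc.mul (ha j s))
    refine ⟨fun y => ∑ j ∈ Finset.range (k + 1), ∑ s : Fin j → Fin n, w' j s y,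
      ContDiffOn.sum fun j _ => ContDiffOn.sum fun s _ => hw'c j s, fun h hc hs => ?_⟩
    have hsub : Function.support (D.1 h).1 ⊆ tsupport h.1 := by
      intro x hx
      by_contra hx'
      refine hx (diffOp_eq_zero D ?_)
      filter_upwards [(isClosed_tsupport h.1).isOpen_compl.mem_nhds hx'] with z hz
      exact image_eq_zero_of_notMem_tsupport hz
    have hc' : HasCompactSupport (D.1 h).1 := hc.mono' hsub
    have hs' : tsupport (D.1 h).1 ⊆ e.source :=
      (closure_minimal hsub (isClosed_tsupport h.1)).trans hs
    obtain ⟨hKc, hKt⟩ := isCompact_image_tsupport hc hs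
    set g : EuclideanSpace ℝ (Fin n) → ℂ := e.target.indicator fun y => h.1 (e.symm y) with hg
    have hgc : ContDiff ℝ ∞ g := contDiff_indicator e.open_target hKc.isClosed hKt
      (contDiffOn_comp_symm h he) (comp_symm_eq_zero h)
    have hgsub : Function.support g ⊆ e '' tsupport h.1 := by
      intro y hy
      by_contra hy'
      refine hy ?_
      by_cases hyt : y ∈ e.target
      · simp [hg, hyt, comp_symm_eq_zero h y hyt hy']
      · simp [hg, hyt]
    have hgts : tsupport g ⊆ e '' tsupport h.1 := closure_minimal hgsub hKc.isClosed
    have hgcs : HasCompactSupport g := hKc.of_isClosed_subset (isClosed_tsupport g) hgts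
    have hge : ∀ y ∈ e.target, (fun y => h.1 (e.symm y)) =ᶠ[𝓝 y] g := by
      intro y hy
      filter_upwards [e.open_target.mem_nhds hy] with z hz
      simp [hg, hz]
    rw [LinearMap.comp_apply, hw _ hc' hs']
    have e1 : ∀ y ∈ e.target, w y * (D.1 h).1 (e.symm y) =
        ∑ j ∈ Finset.range (k + 1), ∑ s : Fin j → Fin n, w y * a j s y *
          iteratedFDeriv ℝ j g y (fun i => EuclideanSpace.single (s i) (1 : ℝ)) := by
      intro y hy
      simp only [H h y hy, Finset.mul_sum, mul_assoc]
      refine Finset.sum_congr rfl fun j _ => Finset.sum_congr rfl fun s _ => ?_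
      rw [((hge y hy).iteratedFDeriv ℝ j).eq_of_nhds]
    have e2 : ∀ y ∈ e.target,
        (∑ j ∈ Finset.range (k + 1), ∑ s : Fin j → Fin n, w' j s y) * h.1 (e.symm y) =
        ∑ j ∈ Finset.range (k + 1), ∑ s : Fin j → Fin n, w' j s y * g y := by
      intro y hy
      simp only [Finset.sum_mul]
      rw [← (hge y hy).eq_of_nhds]
    rw [setIntegral_congr_fun e.open_target.measurableSet e1,
      setIntegral_congr_fun e.open_target.measurableSet e2]
    have i1 : ∀ (j : ℕ) (s : Fin j → Fin n), IntegrableOn (fun y => w y * a j s y *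
        iteratedFDeriv ℝ j g y (fun i => EuclideanSpace.single (s i) (1 : ℝ))) e.target := by
      intro j s
      have hcont : Continuous fun y =>
          iteratedFDeriv ℝ j g y (fun i => EuclideanSpace.single (s i) (1 : ℝ)) :=
        (ContinuousMultilinearMap.apply ℝ (fun _ : Fin j => EuclideanSpace ℝ (Fin n)) ℂ
          _).continuous.comp (hgc.continuous_iteratedFDeriv (by exact_mod_cast le_top))
      refine integrableOn_of_zero_off e.open_target hKc hKt
        ((hwc.continuousOn.mul (ha j s).continuousOn).mul hcont.continuousOn) fun y _ hy => ?_
      have : iteratedFDeriv ℝ j g y = 0 := by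
        by_contra h'
        exact hy (hgts (support_iteratedFDeriv_subset (𝕜 := ℝ) (n := j) h'))
      simp [this]
    have i2 : ∀ (j : ℕ) (s : Fin j → Fin n), IntegrableOn (fun y => w' j s y * g y) e.target :=
      fun j s => integrableOn_of_zero_off e.open_target hKc hKt
        ((hw'c j s).continuousOn.mul hgc.continuous.continuousOn) fun y _ hy => by
          have : g y = 0 := by
            by_contra h'
            exact hy (hgsub h')
          simp [this]
    rw [integral_finsetSum _ fun j _ => integrable_finsetSum _ fun s _ => i1 j s,
      integral_finsetSum _ fun j _ => integrable_finsetSum _ fun s _ => i2 j s]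
    refine Finset.sum_congr rfl fun j _ => ?_
    rw [integral_finsetSum _ fun s _ => i1 j s, integral_finsetSum _ fun s _ => i2 j s]
    exact Finset.sum_congr rfl fun s _ => hw' j s g hgc hgcs (hgts.trans hKt)

/-- The transpose of a differential operator, acting on the compactly supported smooth densities
on `U` by `⟨Dᵗρ, h⟩ = ⟨ρ, D h⟩` for all smooth functions `h`. -/
def transpose [IsManifold (𝓡 n) ∞ M] {k : ℕ} (D : DiffOp n M k) (U : Opens M) :
    Density (n := n) U →ₗ[ℂ] Density (n := n) U where
  toFun ρ := ⟨ρ.1 ∘ₗ D.1, comp_diffOp_mem D ρ.2⟩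
  map_add' _ _ := rfl
  map_smul' _ _ := rfl

/-- The action of a differential operator on generalized functions on `U`: `D f` is the linear form
`ρ ↦ f(Dᵗρ)` on densities. -/
def applyGen [IsManifold (𝓡 n) ∞ M] [T2Space M] {k : ℕ} (D : DiffOp n M k) {U : Opens M}
    (f : GeneralizedFunction (n := n) U) : Density (n := n) U →ₗ[ℂ] ℂ :=
  f.toLinearMap ∘ₗ transpose D U

/-- The coordinate vector field `∂_i` of the coordinate system `e` at the point `x`. -/
noncomputable def coordVec (e : OpenPartialHomeomorph M (EuclideanSpace ℝ (Fin n))) (x : M)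
    (i : Fin n) : TangentSpace (𝓡 n) x :=
  (mfderiv (𝓡 n) (𝓡 n) e.symm (e x) (EuclideanSpace.single i (1 : ℝ)) : EuclideanSpace ℝ (Fin n))

/-- A real tangent vector as an element of the symmetric algebra of the complexified tangent
space. -/
noncomputable def toSym {x : M} (v : TangentSpace (𝓡 n) x) :
    SymmetricAlgebra ℂ (ℂ ⊗[ℝ] TangentSpace (𝓡 n) x) :=
  SymmetricAlgebra.ι ℂ _ (1 ⊗ₜ[ℝ] v)

/-- `σ` is the value at `x` of the principal symbol `σ_k(D)`: in every coordinate system around `x`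
it is the sum of the `a_s(x) ∂_{s_1} ⋯ ∂_{s_k}`, where the `a_s` are the coefficients of
order `k` of `D`. -/
def IsPrincipalSymbol {k : ℕ} (D : DiffOp n M k) (x : M)
    (σ : SymmetricAlgebra ℂ (ℂ ⊗[ℝ] TangentSpace (𝓡 n) x)) : Prop :=
  ∀ e ∈ Charts n M, x ∈ e.source → ∀ a, IsLocalExpression k D.1 e a →
    σ = ∑ s : Fin k → Fin n, a k s (e x) • ∏ i, toSym (coordVec e x (s i))

/-! ### Submanifolds and pseudo-Riemannian geometry -/

variable (n) in
/-- `Z` is a (locally closed, embedded) submanifold of `M`: around each of its points there is a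
coordinate system in which `Z` is an affine subspace. -/
def IsSubmanifold (Z : Set M) : Prop :=
  ∀ z ∈ Z, ∃ e ∈ Charts n M, z ∈ e.source ∧ ∃ W : Submodule ℝ (EuclideanSpace ℝ (Fin n)),
    ∀ x ∈ e.source, x ∈ Z ↔ e x - e z ∈ W

variable (n) in
/-- The tangent space of a submanifold `Z` at `z`: the velocities at `z` of the smooth curves in
`Z` through `z`. -/
noncomputable def tangentSubspace (Z : Set M) (z : M) : Submodule ℝ (TangentSpace (𝓡 n) z) :=
  Submodule.span ℝ {v | ∃ γ : ℝ → M, γ 0 = z ∧ (∀ᶠ t in 𝓝 0, γ t ∈ Z) ∧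
    ContMDiffAt 𝓘(ℝ, ℝ) (𝓡 n) ∞ γ 0 ∧
    (mfderiv 𝓘(ℝ, ℝ) (𝓡 n) γ 0 (1 : ℝ) : EuclideanSpace ℝ (Fin n)) = v}

variable (n M) in
/-- A pseudo-Riemannian metric: a smooth family of nondegenerate symmetric bilinear forms on the
tangent spaces. -/
structure PseudoRiemannianMetric [IsManifold (𝓡 n) ∞ M] where
  /-- The bilinear form on the tangent space at a point. -/
  form (x : M) : TangentSpace (𝓡 n) x →L[ℝ] TangentSpace (𝓡 n) x →L[ℝ] ℝ
  symm (x : M) (v w : TangentSpace (𝓡 n) x) : form x v w = form x w v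
  nondegenerate (x : M) (v : TangentSpace (𝓡 n) x) : (∀ w, form x v w = 0) → v = 0
  contMDiff : ContMDiff (𝓡 n)
    ((𝓡 n).prod 𝓘(ℝ, EuclideanSpace ℝ (Fin n) →L[ℝ] EuclideanSpace ℝ (Fin n) →L[ℝ] ℝ)) ∞
    (fun x => Bundle.TotalSpace.mk'
      (EuclideanSpace ℝ (Fin n) →L[ℝ] EuclideanSpace ℝ (Fin n) →L[ℝ] ℝ)
      (E := fun x : M => TangentSpace (𝓡 n) x →L[ℝ] TangentSpace (𝓡 n) x →L[ℝ] ℝ) x (form x))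

namespace PseudoRiemannianMetric

variable [IsManifold (𝓡 n) ∞ M] (g : PseudoRiemannianMetric n M)

/-- All tangent spaces of `Z` are contained in proper nondegenerate subspaces of the tangent spaces
of `M`. -/
def IsMetricallyProper (Z : Set M) : Prop :=
  ∀ z ∈ Z, ∃ N : Submodule ℝ (TangentSpace (𝓡 n) z), tangentSubspace n Z z ≤ N ∧ N ≠ ⊤ ∧
    ∀ v ∈ N, (∀ w ∈ N, g.form z v w = 0) → v = 0

/-- At every point the principal symbol of `D` is `u_1 v_1 + ⋯ + u_n v_n`, for a basis
`u_1, …, u_n` of the tangent space and the dual basis `v_1, …, v_n` with respect to the metric. -/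
def IsLaplacianType (D : DiffOp n M 2) : Prop :=
  ∀ x : M, ∃ u v : Module.Basis (Fin n) ℝ (TangentSpace (𝓡 n) x),
    (∀ i j, g.form x (u i) (v j) = if i = j then 1 else 0) ∧
    IsPrincipalSymbol D x (∑ i, toSym (u i) * toSym (v i))

end PseudoRiemannianMetric

end Manifold

end GenFun

namespace GenFun

/-! ### Operators on test functions supported in a compact set -/

section Euclidean

variable {E : Type*} [NormedAddCommGroup E] [NormedSpace ℝ E] {K : Compacts E}

/-! The principle is that a distribution supported in a hypersurface cannot be annihilated by a
second order operator for which the hypersurface is noncharacteristic; metric properness places Z,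
near each of its points, inside such a hypersurface.

Let z be a point of Z and N a proper nondegenerate subspace containing the tangent space of Z. The
orthogonal of N contains a vector w with ⟨w,w⟩ ≠ 0 (`exists_orthogonal_apply_self_ne_zero`). The
covector ⟨w,·⟩ vanishes along Z, and the symbol of D takes the value ⟨w,w⟩ on it
(`sum_apply_mul_apply_dual`). In coordinates where Z is an affine subspace, the affine function h
with differential ⟨w,·⟩ that vanishes at z therefore vanishes on Z, and q = σ₂(D)(dh) is nonzero at
z, hence on a ball K by continuity of the coefficients.

On K, f becomes a distribution F carried by {h = 0}. Continuity bounds F by finitely many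
derivatives, so F kills some power of h (`exists_powMul_eq_zero`). The transpose L of D satisfies
L(h^(m+2) χ) = h^(m+1) χ' + (m+2)(m+1) h^m q χ, since only two derivatives falling on h can remove
two powers. As F ∘ L = 0 and q is invertible on K, F kills h^m as soon as it kills h^(m+1);
descending to m = 0 gives F = 0 (`eq_zero_of_powMul_eq_zero`).

Thus f vanishes near each point of Z. It does so off its support by definition, and a partition of
unity gives f = 0 (`apply_eq_zero_of_locally_eq_zero`). -/

/-- Multiplication of test functions supported in `K` by a function that is smooth near `K`. -/
noncomputable def smoothMul {a : E → ℂ} (ha : ∀ y ∈ K, ContDiffAt ℝ ∞ a y) :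
    𝓓_{K}(E, ℂ) →ₗ[ℂ] 𝓓_{K}(E, ℂ) where
  toFun χ :=
    { toFun := fun y => a y * χ y
      contDiff' := by
        rw [contDiff_iff_contDiffAt]
        intro y
        by_cases hy : y ∈ K
        · exact (ha y hy).mul χ.contDiff.contDiffAt
        · refine (contDiffAt_const (c := (0 : ℂ))).congr_of_eventuallyEq ?_
          filter_upwards [K.isCompact.isClosed.isOpen_compl.mem_nhds hy] with z hz
          simp [χ.zero_on_compl hz]
      zero_on_compl' := fun y hy => by simp [χ.zero_on_compl hy] }
  map_add' χ χ' := by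
    ext y
    exact mul_add _ _ _
  map_smul' c χ := by
    ext y
    exact mul_left_comm _ _ _

theorem smoothMul_apply {a : E → ℂ} (ha : ∀ y ∈ K, ContDiffAt ℝ ∞ a y) (χ : 𝓓_{K}(E, ℂ)) (y : E) :
    smoothMul ha χ y = a y * χ y := rfl

/-- The directional derivative of test functions supported in `K`. -/
noncomputable def dirDeriv (v : E) : 𝓓_{K}(E, ℂ) →ₗ[ℂ] 𝓓_{K}(E, ℂ) where
  toFun χ :=
    { toFun := fun y => fderiv ℝ χ y v
      contDiff' := (χ.contDiff.fderiv_right (by simp)).clm_apply contDiff_const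
      zero_on_compl' := fun y hy => by
        have : fderiv ℝ χ y = 0 := image_eq_zero_of_notMem_tsupport
          fun h => hy (χ.tsupport_subset (tsupport_fderiv_subset ℝ h))
        simp [this] }
  map_add' χ χ' := by
    ext y
    change fderiv ℝ (⇑(χ + χ')) y v = fderiv ℝ χ y v + fderiv ℝ χ' y v
    rw [FunLike.coe_add, fderiv_add (χ.contDiff.differentiable (by simp) y)
      (χ'.contDiff.differentiable (by simp) y)]
    rfl
  map_smul' c χ := by
    ext y
    change fderiv ℝ (⇑(c • χ)) y v = c • fderiv ℝ χ y v
    rw [FunLike.coe_smul, fderiv_const_smul (χ.contDiff.differentiable (by simp) y)]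
    rfl

theorem dirDeriv_apply (v : E) (χ : 𝓓_{K}(E, ℂ)) (y : E) : dirDeriv v χ y = fderiv ℝ χ y v := rfl

/-- The transpose of the iterated directional derivative `∂_{v_1} ⋯ ∂_{v_j}`. -/
noncomputable def transposeDeriv : (j : ℕ) → (Fin j → E) → 𝓓_{K}(E, ℂ) →ₗ[ℂ] 𝓓_{K}(E, ℂ)
  | 0, _ => LinearMap.id
  -- In `iteratedFDeriv` the direction `v 0` is the outermost derivative, so its transpose acts
  -- first.
  | j + 1, v => transposeDeriv j (Fin.tail v) ∘ₗ (-dirDeriv (v 0))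

theorem contDiffOn_iteratedFDeriv_apply {O : Set E} (hO : IsOpen O) {w : E → ℂ}
    (hw : ContDiffOn ℝ ∞ w O) (j : ℕ) (v : Fin j → E) :
    ContDiffOn ℝ ∞ (fun y => iteratedFDeriv ℝ j w y v) O := fun y hy =>
  (((ContinuousMultilinearMap.apply ℝ (fun _ : Fin j => E) ℂ v).contDiff.contDiffAt).comp y
    ((hw.contDiffAt (hO.mem_nhds hy)).iteratedFDeriv_right (m := ∞)
      (by exact_mod_cast le_top))).contDiffWithinAt

theorem fderiv_iteratedFDeriv_apply {O : Set E} (hO : IsOpen O) {w : E → ℂ}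
    (hw : ContDiffOn ℝ ∞ w O) (j : ℕ) (v : Fin (j + 1) → E) {y : E} (hy : y ∈ O) :
    fderiv ℝ (fun y => iteratedFDeriv ℝ j w y (Fin.tail v)) y (v 0) =
      iteratedFDeriv ℝ (j + 1) w y v := by
  have hd : DifferentiableAt ℝ (iteratedFDeriv ℝ j w) y :=
    ((hw.contDiffAt (hO.mem_nhds hy)).iteratedFDeriv_right (m := ∞)
      (by exact_mod_cast le_top)).differentiableAt (by simp)
  have := ((ContinuousMultilinearMap.apply ℝ (fun _ : Fin j => E) ℂ
      (Fin.tail v)).hasFDerivAt.comp y hd.hasFDerivAt).fderiv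
  rw [iteratedFDeriv_succ_apply_left]
  exact DFunLike.congr_fun this (v 0)

/-- Integration by parts has no boundary terms because the test function has compact support in `O`.
The derivatives land on the test function through an explicit operator, whose effect on powers of an
affine function can then be computed. -/
theorem integral_mul_iteratedFDeriv [MeasurableSpace E] [BorelSpace E] [FiniteDimensional ℝ E]
    {μ : Measure E} [μ.IsAddHaarMeasure] {O : Set E} (hO : IsOpen O) (hK : (K : Set E) ⊆ O)
    {w : E → ℂ} (hw : ContDiffOn ℝ ∞ w O) (j : ℕ) :
    ∀ (v : Fin j → E) (χ : 𝓓_{K}(E, ℂ)),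
      ∫ y in O, χ y * iteratedFDeriv ℝ j w y v ∂μ = ∫ y in O, transposeDeriv j v χ y * w y ∂μ := by
  induction j with
  | zero => intro v χ; simp [transposeDeriv]
  | succ j ih =>
    intro v χ
    have h1 := integral_mul_fderiv (μ := μ) hO (contDiffOn_iteratedFDeriv_apply hO hw j (Fin.tail v))
      χ.contDiff χ.hasCompactSupport (χ.tsupport_subset.trans hK) (v 0)
    rw [transposeDeriv, LinearMap.comp_apply, ← ih]
    have h2 : ∫ y in O, (-dirDeriv (v 0) : 𝓓_{K}(E, ℂ) →ₗ[ℂ] 𝓓_{K}(E, ℂ)) χ y *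
        iteratedFDeriv ℝ j w y (Fin.tail v) ∂μ =
        -∫ y in O, iteratedFDeriv ℝ j w y (Fin.tail v) * fderiv ℝ χ y (v 0) ∂μ := by
      rw [← integral_neg]
      refine integral_congr_ae (Filter.Eventually.of_forall fun y => ?_)
      change -(fderiv ℝ χ y (v 0)) * _ = _
      ring
    rw [h2, h1, ← integral_neg]
    refine setIntegral_congr_fun hO.measurableSet fun y hy => ?_
    simp only [fderiv_iteratedFDeriv_apply hO hw j v hy]
    ring

/-! ### Powers of an affine function -/

/-- The complex valued affine function `y ↦ ℓ (y - y₀)`. -/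
noncomputable def affineFn (ℓ : E →L[ℝ] ℝ) (y₀ y : E) : ℂ := ((ℓ (y - y₀) : ℝ) : ℂ)

theorem contDiff_affineFn (ℓ : E →L[ℝ] ℝ) (y₀ : E) : ContDiff ℝ ∞ (affineFn ℓ y₀) :=
  Complex.ofRealCLM.contDiff.comp (ℓ.contDiff.comp (contDiff_id.sub contDiff_const))

theorem hasFDerivAt_affineFn (ℓ : E →L[ℝ] ℝ) (y₀ y : E) :
    HasFDerivAt (affineFn ℓ y₀) (Complex.ofRealCLM ∘L ℓ) y :=
  Complex.ofRealCLM.hasFDerivAt.comp y (ℓ.hasFDerivAt.comp y ((hasFDerivAt_id y).sub_const y₀))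

/-- Multiplication of test functions by the powers of an affine function. -/
noncomputable def powMul (ℓ : E →L[ℝ] ℝ) (y₀ : E) (m : ℕ) : 𝓓_{K}(E, ℂ) →ₗ[ℂ] 𝓓_{K}(E, ℂ) :=
  smoothMul (a := fun y => affineFn ℓ y₀ y ^ m) fun _ _ =>
    ((contDiff_affineFn ℓ y₀).pow m).contDiffAt

theorem powMul_apply (ℓ : E →L[ℝ] ℝ) (y₀ : E) (m : ℕ) (χ : 𝓓_{K}(E, ℂ)) (y : E) :
    powMul ℓ y₀ m χ y = affineFn ℓ y₀ y ^ m * χ y := rfl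

theorem powMul_powMul (ℓ : E →L[ℝ] ℝ) (y₀ : E) (m k : ℕ) (χ : 𝓓_{K}(E, ℂ)) :
    powMul ℓ y₀ m (powMul ℓ y₀ k χ) = powMul ℓ y₀ (m + k) χ := by
  ext y
  simp only [powMul_apply]
  ring

theorem smoothMul_powMul {a : E → ℂ} (ha : ∀ y ∈ K, ContDiffAt ℝ ∞ a y) (ℓ : E →L[ℝ] ℝ) (y₀ : E)
    (m : ℕ) (χ : 𝓓_{K}(E, ℂ)) :
    smoothMul ha (powMul ℓ y₀ m χ) = powMul ℓ y₀ m (smoothMul ha χ) := by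
  ext y
  simp only [powMul_apply, smoothMul_apply]
  ring

theorem dirDeriv_powMul (ℓ : E →L[ℝ] ℝ) (y₀ : E) (m : ℕ) (χ : 𝓓_{K}(E, ℂ)) (v : E) :
    dirDeriv v (powMul ℓ y₀ (m + 1) χ) =
      powMul ℓ y₀ m (((m + 1) * ℓ v : ℂ) • χ) + powMul ℓ y₀ (m + 1) (dirDeriv v χ) := by
  ext y
  have h := ((hasFDerivAt_affineFn ℓ y₀ y).pow (m + 1)).mul
    (χ.contDiff.differentiable (by simp) y).hasFDerivAt
  have h2 : fderiv ℝ (powMul ℓ y₀ (m + 1) χ) y = _ := h.fderiv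
  rw [dirDeriv_apply, h2]
  change _ = affineFn ℓ y₀ y ^ m * (((m + 1) * ℓ v : ℂ) * χ y) +
    affineFn ℓ y₀ y ^ (m + 1) * fderiv ℝ χ y v
  simp
  ring

/-- A derivative of order at most one lowers the power of the affine function by at most one, so the
terms of D of order 0 and 1 only contribute to the remainder in the descent. -/
theorem exists_transposeDeriv_powMul (ℓ : E →L[ℝ] ℝ) (y₀ : E) (m : ℕ) {j : ℕ} (hj : j ≤ 1)
    (v : Fin j → E) (χ : 𝓓_{K}(E, ℂ)) :
    ∃ χ', transposeDeriv j v (powMul ℓ y₀ (m + 2) χ) = powMul ℓ y₀ (m + 1) χ' := by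
  interval_cases j
  · exact ⟨powMul ℓ y₀ 1 χ, by rw [powMul_powMul]; rfl⟩
  · refine ⟨-((((m + 1 : ℕ) + 1) * ℓ (v 0) : ℂ) • χ + powMul ℓ y₀ 1 (dirDeriv (v 0) χ)), ?_⟩
    change -dirDeriv (v 0) (powMul ℓ y₀ (m + 1 + 1) χ) = _
    rw [dirDeriv_powMul, map_neg, map_add, powMul_powMul]

/-- Two powers are lost only when both derivatives fall on the affine factor. This isolates the
quadratic form `ℓ (v 0) * ℓ (v 1)`, from which the principal symbol at `ℓ` is assembled. The two
signs of the transpose cancel. -/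
theorem exists_transposeDeriv_two_powMul (ℓ : E →L[ℝ] ℝ) (y₀ : E) (m : ℕ)
    (v : Fin 2 → E) (χ : 𝓓_{K}(E, ℂ)) :
    ∃ χ', transposeDeriv 2 v (powMul ℓ y₀ (m + 2) χ) = powMul ℓ y₀ (m + 1) χ' +
      powMul ℓ y₀ m (((m + 2) * (m + 1) * (ℓ (v 0) * ℓ (v 1)) : ℂ) • χ) := by
  have h : transposeDeriv 2 v (powMul ℓ y₀ (m + 2) χ) =
      dirDeriv (v 1) (dirDeriv (v 0) (powMul ℓ y₀ (m + 1 + 1) χ)) := by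
    change -dirDeriv (v 1) (-dirDeriv (v 0) (powMul ℓ y₀ (m + 1 + 1) χ)) = _
    rw [map_neg, neg_neg]
  rw [h, dirDeriv_powMul, map_add, dirDeriv_powMul, dirDeriv_powMul]
  -- The terms of Leibniz's rule in which at most one derivative hits the power, with `m + 1`
  -- factors taken out.
  refine ⟨dirDeriv (v 1) ((((m + 1 : ℕ) + 1) * ℓ (v 0) : ℂ) • χ) +
    (((m + 1 : ℕ) + 1) * ℓ (v 1) : ℂ) • dirDeriv (v 0) χ +
    powMul ℓ y₀ 1 (dirDeriv (v 1) (dirDeriv (v 0) χ)), ?_⟩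
  rw [map_add, map_add, powMul_powMul, smul_smul]
  have : ((m + 1) * ℓ (v 1) * (((m + 1 : ℕ) + 1) * ℓ (v 0)) : ℂ) =
      (m + 2) * (m + 1) * (ℓ (v 0) * ℓ (v 1)) := by push_cast; ring
  rw [this]
  abel

/-- If a linear form on test functions kills a power of an affine function and is annihilated by
a second order operator `L` for which the zero set of the affine function is noncharacteristic,
then it vanishes. -/
theorem eq_zero_of_powMul_eq_zero {F : 𝓓_{K}(E, ℂ) →ₗ[ℂ] ℂ} (ℓ : E →L[ℝ] ℝ) (y₀ : E)
    {L : 𝓓_{K}(E, ℂ) → 𝓓_{K}(E, ℂ)} (hFL : ∀ χ, F (L χ) = 0) {q : E → ℂ}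
    (hq : ∀ y ∈ K, ContDiffAt ℝ ∞ q y) (hq0 : ∀ y ∈ K, q y ≠ 0)
    (hL : ∀ m χ, ∃ χ', L (powMul ℓ y₀ (m + 2) χ) = powMul ℓ y₀ (m + 1) χ' +
      powMul ℓ y₀ m (((m + 2) * (m + 1) : ℂ) • smoothMul hq χ))
    (m : ℕ) (hm : ∀ χ, F (powMul ℓ y₀ m χ) = 0) (χ : 𝓓_{K}(E, ℂ)) : F χ = 0 := by
  induction m with
  | zero =>
    rw [← hm χ]
    congr 1
    ext y
    simp [powMul_apply]
  | succ m ih =>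
    refine ih fun χ => ?_
    have hq' : ∀ y ∈ K, ContDiffAt ℝ ∞ (fun y => (q y)⁻¹) y :=
      fun y hy => (hq y hy).inv (hq0 y hy)
    -- Dividing by `q` beforehand turns the leading term into a nonzero multiple of `powMul ℓ y₀ m
    -- χ` for the arbitrary given `χ`. `F` kills the left side by `hFL` and the remainder by `hm`.
    obtain ⟨χ', h⟩ := hL m (smoothMul hq' χ)
    have h1 : smoothMul hq (smoothMul hq' χ) = χ := by
      ext y
      simp only [smoothMul_apply]
      by_cases hy : y ∈ K
      · rw [mul_inv_cancel_left₀ (hq0 y hy)]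
      · simp [χ.zero_on_compl hy]
    have h2 := hFL (powMul ℓ y₀ (m + 2) (smoothMul hq' χ))
    rw [h, h1, map_add, hm, zero_add, map_smul, map_smul, smul_eq_mul] at h2
    refine (mul_eq_zero.1 h2).resolve_left ?_
    have : (((m + 2) * (m + 1) : ℕ) : ℂ) ≠ 0 := Nat.cast_ne_zero.2 (by positivity)
    simpa using this

/-! ### Distributions supported in a hyperplane have finite transversal order -/

theorem norm_iteratedFDeriv_comp_affine_le {η : ℝ → ℂ} (hη : ContDiff ℝ ∞ η) (ℓ : E →L[ℝ] ℝ)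
    (y₀ y : E) (i : ℕ) :
    ‖iteratedFDeriv ℝ i (fun z => η (ℓ (z - y₀))) y‖ ≤
      ‖iteratedFDeriv ℝ i η (ℓ (y - y₀))‖ * ‖ℓ‖ ^ i := by
  rw [iteratedFDeriv_comp_sub (f := fun z => η (ℓ z)) i y₀ y]
  change ‖iteratedFDeriv ℝ i (η ∘ ℓ) (y - y₀)‖ ≤ _
  rw [ℓ.iteratedFDeriv_comp_right hη _ (by exact_mod_cast le_top)]
  refine (ContinuousMultilinearMap.norm_compContinuousLinearMap_le _ _).trans ?_
  simp

/-- Each derivative of `η (ℓ / ε)` costs a factor `ε⁻¹`. With at most `k` of them, the prefactor `ε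
^ (k + 1)` leaves at least one power of `ε`. -/
theorem norm_iteratedFDeriv_rescaled_le {η : ℝ → ℂ} (hη : ContDiff ℝ ∞ η) (ℓ : E →L[ℝ] ℝ)
    (y₀ y : E) {k p : ℕ} (hp : p ≤ k) {A : ℝ} (hA : ∀ t, ‖iteratedFDeriv ℝ p η t‖ ≤ A) {ε : ℝ}
    (hε : 0 < ε) (hε1 : ε ≤ 1) :
    ‖iteratedFDeriv ℝ p (fun z => (ε : ℂ) ^ (k + 1) * η (ε⁻¹ * ℓ (z - y₀))) y‖ ≤
      A * ‖ℓ‖ ^ p * ε := by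
  have hη' : ContDiff ℝ ∞ fun z => η ((ε⁻¹ • ℓ) (z - y₀)) :=
    hη.comp ((ε⁻¹ • ℓ).contDiff.comp (contDiff_id.sub contDiff_const))
  have hA0 : 0 ≤ A := (norm_nonneg _).trans (hA 0)
  change ‖iteratedFDeriv ℝ p ((ε : ℂ) ^ (k + 1) • fun z => η ((ε⁻¹ • ℓ) (z - y₀))) y‖ ≤ _
  rw [iteratedFDeriv_const_smul_apply (hη'.contDiffAt.of_le (by exact_mod_cast le_top)),
    norm_smul]
  have h2 := (norm_iteratedFDeriv_comp_affine_le hη (ε⁻¹ • ℓ) y₀ y p).trans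
    (mul_le_mul_of_nonneg_right (hA _) (by positivity))
  rw [norm_smul, Real.norm_of_nonneg (by positivity : (0 : ℝ) ≤ ε⁻¹), mul_pow] at h2
  have h3 : ‖(ε : ℂ) ^ (k + 1)‖ = ε ^ (k + 1) := by
    rw [norm_pow, Complex.norm_real, Real.norm_of_nonneg hε.le]
  rw [h3]
  refine (mul_le_mul_of_nonneg_left h2 (by positivity)).trans ?_
  have h4 : ε ^ (k + 1) * ε⁻¹ ^ p ≤ ε := by
    obtain ⟨r, rfl⟩ := Nat.exists_eq_add_of_le hp
    have : ε ^ (p + r + 1) * ε⁻¹ ^ p = ε ^ r * ε := by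
      rw [inv_pow]
      field_simp
      ring
    rw [this]
    exact mul_le_of_le_one_left hε.le (pow_le_one₀ hε.le hε1)
  calc ε ^ (k + 1) * (A * (ε⁻¹ ^ p * ‖ℓ‖ ^ p))
      = (A * ‖ℓ‖ ^ p) * (ε ^ (k + 1) * ε⁻¹ ^ p) := by ring
    _ ≤ (A * ‖ℓ‖ ^ p) * ε := mul_le_mul_of_nonneg_left h4 (by positivity)

/-- Bounds for the derivatives of the functions `ε ^ (k + 1) η(ℓ / ε) ψ`. -/
theorem exists_seminorm_le_mul {η : ℝ → ℂ} (hη : ContDiff ℝ ∞ η) (hηc : HasCompactSupport η)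
    (ℓ : E →L[ℝ] ℝ) (y₀ : E) (ψ : 𝓓_{K}(E, ℂ)) (k i : ℕ) (hi : i ≤ k) :
    ∃ C : ℝ, ∀ ε : ℝ, 0 < ε → ε ≤ 1 → ∀ φ : 𝓓_{K}(E, ℂ),
      (∀ y, φ y = ε ^ (k + 1) * η (ε⁻¹ * ℓ (y - y₀)) * ψ y) →
      ContDiffMapSupportedIn.seminorm ℂ E ℂ ⊤ K i φ ≤ C * ε := by
  have hb : ∀ p : ℕ, ∃ C, ∀ t, ‖iteratedFDeriv ℝ p η t‖ ≤ C := fun p =>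
    (hη.continuous_iteratedFDeriv (by exact_mod_cast le_top)).bounded_above_of_compact_support
      (hηc.iteratedFDeriv p)
  choose A hA using hb
  have hA0 : ∀ p, 0 ≤ A p := fun p => (norm_nonneg _).trans (hA p 0)
  obtain ⟨S, hS⟩ : ∃ S : ℕ → ℝ, ∀ p y, ‖iteratedFDeriv ℝ p ψ y‖ ≤ S p :=
    ⟨_, fun p y => ContDiffMapSupportedIn.norm_iteratedFDeriv_apply_le_seminorm_top ℂ⟩
  have hS0 : ∀ p, 0 ≤ S p := fun p => (norm_nonneg _).trans (hS p 0)
  -- The bound is Leibniz's formula, with `A p` bounding the derivatives of `η` and `S (i - p)`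
  -- those of `ψ`; it does not involve `ε`.
  refine ⟨∑ p ∈ Finset.range (i + 1), (i.choose p : ℝ) * (A p * ‖ℓ‖ ^ p) * S (i - p),
    fun ε hε hε1 φ hφ => ?_⟩
  have hC0 : 0 ≤ ∑ p ∈ Finset.range (i + 1), (i.choose p : ℝ) * (A p * ‖ℓ‖ ^ p) * S (i - p) :=
    Finset.sum_nonneg fun p _ => mul_nonneg
      (mul_nonneg (Nat.cast_nonneg _) (mul_nonneg (hA0 p) (by positivity))) (hS0 _)
  rw [ContDiffMapSupportedIn.seminorm_top_le_iff ℂ (mul_nonneg hC0 hε.le)]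
  intro y _
  have hη' : ContDiff ℝ ∞ fun z => (ε : ℂ) ^ (k + 1) * η (ε⁻¹ * ℓ (z - y₀)) :=
    contDiff_const.mul
      (hη.comp (contDiff_const.mul (ℓ.contDiff.comp (contDiff_id.sub contDiff_const))))
  rw [show (φ : E → ℂ) = fun z => (ε : ℂ) ^ (k + 1) * η (ε⁻¹ * ℓ (z - y₀)) * ψ z from funext hφ]
  refine (norm_iteratedFDeriv_mul_le (N := ∞) hη' ψ.contDiff y
    (by exact_mod_cast le_top)).trans ?_
  rw [Finset.sum_mul]
  refine Finset.sum_le_sum fun p hp => ?_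
  have hpi : p ≤ i := Nat.lt_succ_iff.1 (Finset.mem_range.1 hp)
  have h1 := norm_iteratedFDeriv_rescaled_le hη ℓ y₀ y (hpi.trans hi) (hA p) hε hε1
  have h3 := mul_le_mul (mul_le_mul_of_nonneg_left h1 (Nat.cast_nonneg (i.choose p)))
    (hS (i - p) y) (norm_nonneg _) (mul_nonneg (Nat.cast_nonneg _)
      (mul_nonneg (mul_nonneg (hA0 p) (by positivity)) hε.le))
  refine h3.trans (le_of_eq ?_)
  ring

/-- A distribution that vanishes on test functions supported off a hyperplane is killed by a power
of the equation of the hyperplane. -/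
theorem exists_powMul_eq_zero (F : 𝓓_{K}(E, ℂ) →L[ℂ] ℂ) (ℓ : E →L[ℝ] ℝ) (y₀ : E)
    (hF : ∀ χ : 𝓓_{K}(E, ℂ), (∀ y ∈ tsupport χ, ℓ (y - y₀) ≠ 0) → F χ = 0) :
    ∃ m, ∀ χ, F (powMul ℓ y₀ m χ) = 0 := by
  obtain ⟨s, C, -, hC⟩ := Seminorm.bound_of_continuous
    (ContDiffMapSupportedIn.withSeminorms ℂ E ℂ ⊤ K) ((normSeminorm ℂ ℂ).comp F.toLinearMap)
    (continuous_norm.comp F.continuous)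
  -- `k` is the highest derivative in the continuity estimate; one more power of the affine function
  -- makes the estimate tend to zero.
  set k := s.sup id
  refine ⟨k + 1, fun ψ => ?_⟩
  let b : ContDiffBump (0 : ℝ) := ⟨1, 2, one_pos, one_lt_two⟩
  have hbs : ContDiff ℝ ∞ fun t => ((b t : ℝ) : ℂ) := Complex.ofRealCLM.contDiff.comp b.contDiff
  -- Chosen so that cutting off `ℓ ^ (k + 1) * ψ` to the slab `|ℓ| < 2ε` gives exactly `ε ^ (k + 1)
  -- * η (ℓ / ε) * ψ`.
  set η : ℝ → ℂ := fun t => b t * (t : ℂ) ^ (k + 1) with hη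
  have hηs : ContDiff ℝ ∞ η := hbs.mul (Complex.ofRealCLM.contDiff.pow _)
  have hηc : HasCompactSupport η := by
    refine HasCompactSupport.mul_right ?_
    exact b.hasCompactSupport.comp_left (g := ((↑) : ℝ → ℂ)) Complex.ofReal_zero
  choose A hA using fun i : s => exists_seminorm_le_mul hηs hηc ℓ y₀ ψ k i.1
    (Finset.le_sup (f := id) i.2)
  set B : ℝ := ∑ i : s, |A i|
  have key : ∀ ε : ℝ, 0 < ε → ε ≤ 1 → ‖F (powMul ℓ y₀ (k + 1) ψ)‖ ≤ C * B * ε := by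
    intro ε hε hε1
    have hcut : ContDiff ℝ ∞ fun y => ((b (ε⁻¹ * ℓ (y - y₀)) : ℝ) : ℂ) :=
      hbs.comp (contDiff_const.mul (ℓ.contDiff.comp (contDiff_id.sub contDiff_const)))
    set φ := smoothMul (K := K) (fun _ _ => hcut.contDiffAt) (powMul ℓ y₀ (k + 1) ψ) with hφ
    -- The cutoff equals 1 near the hyperplane, so the difference is supported away from it.
    have h1 : F (powMul ℓ y₀ (k + 1) ψ) = F φ := by
      rw [← sub_eq_zero, ← map_sub]
      refine hF _ fun y hy h0 => ?_
      have hc : Continuous fun z => ε⁻¹ * ℓ (z - y₀) := by fun_prop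
      have hev : ∀ᶠ z in 𝓝 y, ε⁻¹ * ℓ (z - y₀) ∈ Metric.ball (0 : ℝ) 1 :=
        hc.continuousAt.eventually (Metric.isOpen_ball.mem_nhds (by simp [h0]))
      refine notMem_tsupport_iff_eventuallyEq.2 (hev.mono fun z hz => ?_) hy
      have hb1 : b (ε⁻¹ * ℓ (z - y₀)) = 1 := b.one_of_mem_closedBall (Metric.ball_subset_closedBall hz)
      change powMul ℓ y₀ (k + 1) ψ z - φ z = 0
      rw [hφ, smoothMul_apply, hb1]
      simp
    have h2 : ∀ y, φ y = ε ^ (k + 1) * η (ε⁻¹ * ℓ (y - y₀)) * ψ y := by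
      intro y
      rw [hφ, smoothMul_apply, powMul_apply, hη, affineFn]
      have : (ε : ℂ) ≠ 0 := by exact_mod_cast hε.ne'
      push_cast
      rw [mul_pow, inv_pow]
      field_simp
    rw [h1]
    refine (hC φ).trans ?_
    change (C : ℝ) * (s.sup (ContDiffMapSupportedIn.seminorm ℂ E ℂ ⊤ K)) φ ≤ _
    rw [mul_assoc]
    refine mul_le_mul_of_nonneg_left ?_ C.coe_nonneg
    have hB : 0 ≤ B := Finset.sum_nonneg fun _ _ => abs_nonneg _
    refine Seminorm.finset_sup_apply_le (by positivity) fun i hi => ?_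
    refine (hA ⟨i, hi⟩ ε hε hε1 φ h2).trans ?_
    refine mul_le_mul_of_nonneg_right ((le_abs_self _).trans ?_) hε.le
    exact Finset.single_le_sum (f := fun i : s => |A i|) (fun _ _ => abs_nonneg _)
      (Finset.mem_univ (⟨i, hi⟩ : s))
  have hlim : Filter.Tendsto (fun ε : ℝ => C * B * ε) (𝓝[>] 0) (𝓝 0) := by
    have : Filter.Tendsto (fun ε : ℝ => C * B * ε) (𝓝 0) (𝓝 (C * B * 0)) :=
      (continuous_const.mul continuous_id).tendsto 0
    rw [mul_zero] at this
    exact this.mono_left nhdsWithin_le_nhds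
  have := ge_of_tendsto hlim (b := ‖F (powMul ℓ y₀ (k + 1) ψ)‖) (by
    filter_upwards [Ioc_mem_nhdsGT (zero_lt_one' ℝ)] with ε hε
    exact key ε hε.1 hε.2)
  exact norm_le_zero_iff.1 this

end Euclidean

/-! ### Localization of densities and generalized functions -/

section Localization

variable {n : ℕ} {M : Type*} [TopologicalSpace M] [ChartedSpace (EuclideanSpace ℝ (Fin n)) M]

/-- Multiplication by a smooth function. -/
def mulFn (χ : SmoothFn n M) : SmoothFn n M →ₗ[ℂ] SmoothFn n M where
  toFun h := ⟨fun x => χ.1 x * h.1 x,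
    (contDiff_mul (𝕜 := ℝ) (𝔸 := ℂ)).contMDiff.comp (χ.2.prodMk_space h.2)⟩
  map_add' _ _ := Subtype.ext (funext fun _ => mul_add _ _ _)
  map_smul' _ _ := Subtype.ext (funext fun _ => mul_left_comm _ _ _)

theorem mulFn_apply (χ h : SmoothFn n M) (x : M) : (mulFn χ h).1 x = χ.1 x * h.1 x := rfl

/-- In every chart the factor `χ` is absorbed into the coefficient `w`. The product is carried by
the part of `K` inside the support of `χ`, which lets a density be cut into pieces living on small
open sets. -/
theorem comp_mulFn_mem {U V : Opens M} {ρ : SmoothFn n M →ₗ[ℂ] ℂ} (hρ : ρ ∈ Density U) {K : Set M}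
    (hK : IsCompact K) (h0 : ∀ h : SmoothFn n M, (∀ᶠ x in 𝓝ˢ K, h.1 x = 0) → ρ h = 0)
    (χ : SmoothFn n M) (hV : K ∩ tsupport χ.1 ⊆ V) : ρ ∘ₗ mulFn χ ∈ Density V := by
  refine ⟨⟨K ∩ tsupport χ.1, hK.inter_right (isClosed_tsupport _), hV, fun h hh => h0 _ ?_⟩,
    fun e he => ?_⟩
  · rw [eventually_nhdsSet_iff_forall] at hh ⊢
    intro x hx
    by_cases hxs : x ∈ tsupport χ.1
    · filter_upwards [hh x ⟨hx, hxs⟩] with z hz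
      simp [mulFn_apply, hz]
    · filter_upwards [(isClosed_tsupport χ.1).isOpen_compl.mem_nhds hxs] with z hz
      simp [mulFn_apply, image_eq_zero_of_notMem_tsupport hz]
  · obtain ⟨w, hwc, hw⟩ := hρ.2 e he
    refine ⟨fun y => w y * χ.1 (e.symm y), hwc.mul (contDiffOn_comp_symm χ he), fun h hc hs => ?_⟩
    have hsub : tsupport (mulFn χ h).1 ⊆ tsupport h.1 := tsupport_mul_subset_right
    rw [LinearMap.comp_apply, hw (mulFn χ h) (hc.of_isClosed_subset (isClosed_tsupport _) hsub)
      (hsub.trans hs)]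
    simp only [mulFn_apply, mul_assoc]

variable [IsManifold (𝓡 n) ∞ M] [T2Space M] [SecondCountableTopology M]

theorem sigmaCompact_of_charted (n : ℕ) (M : Type*) [TopologicalSpace M]
    [ChartedSpace (EuclideanSpace ℝ (Fin n)) M] [SecondCountableTopology M] :
    LocallyCompactSpace M ∧ SigmaCompactSpace M := by
  have : LocallyCompactSpace M := ChartedSpace.locallyCompactSpace (EuclideanSpace ℝ (Fin n)) M
  exact ⟨this, inferInstance⟩

/-- A real valued smooth function as a complex valued one. -/
noncomputable def SmoothFn.ofReal (χ : C^∞⟮𝓡 n, M; 𝓘(ℝ, ℝ), ℝ⟯) : SmoothFn n M :=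
  ⟨fun x => (χ x : ℂ), Complex.ofRealCLM.contMDiff.comp χ.contMDiff⟩

/-- A generalized function that vanishes near each point of the support of a density vanishes on
the density. -/
theorem apply_eq_zero_of_locally_eq_zero {U : Opens M} (f : GeneralizedFunction (n := n) U)
    (ρ : Density (n := n) U) {K : Set M} (hK : IsCompact K)
    (h0 : ∀ h : SmoothFn n M, (∀ᶠ x in 𝓝ˢ K, h.1 x = 0) → ρ.1 h = 0)
    (hloc : ∀ x ∈ K, ∃ V : Opens M, x ∈ V ∧ V ≤ U ∧
      ∀ τ : Density (n := n) U, τ.1 ∈ Density (n := n) V → f τ = 0) : f ρ = 0 := by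
  obtain ⟨_, _⟩ := sigmaCompact_of_charted n M
  choose! V hxV hVU hfV using hloc
  obtain ⟨t, htK, ht⟩ := hK.elim_nhds_subcover (fun x => (V x : Set M))
    fun x hx => (V x).isOpen.mem_nhds (hxV x hx)
  -- A density sees functions near `K`, not just on it. The partition must therefore sum to 1 on a
  -- neighbourhood of `K`, so it is taken over the larger `K'`.
  obtain ⟨K', hK', hKK', hK'V⟩ := exists_compact_between hK
    (isOpen_biUnion fun x (_ : x ∈ t) => (V x).isOpen) ht
  obtain ⟨p, hp⟩ := SmoothPartitionOfUnity.exists_isSubordinate (𝓡 n) hK'.isClosed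
    (fun x : t => (V x : Set M)) (fun x => (V x).isOpen)
    (hK'V.trans (by simp [Set.iUnion_subtype]))
  set χ : t → SmoothFn n M := fun x => SmoothFn.ofReal (p x) with hχ
  have hsupp : ∀ x : t, tsupport (χ x).1 ⊆ V x := fun x =>
    (closure_mono fun z hz => by
      simpa [hχ, SmoothFn.ofReal] using hz).trans (hp x)
  have hmem : ∀ x : t, ρ.1 ∘ₗ mulFn (χ x) ∈ Density (V x.1) := fun x =>
    comp_mulFn_mem ρ.2 hK h0 _ (Set.inter_subset_right.trans (hsupp x))
  have hmemU : ∀ x : t, ρ.1 ∘ₗ mulFn (χ x) ∈ Density U := fun x =>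
    comp_mulFn_mem ρ.2 hK h0 _ (Set.inter_subset_right.trans ((hsupp x).trans
      (hVU x (htK x x.2))))
  have hsum : ρ = ∑ x : t, (⟨ρ.1 ∘ₗ mulFn (χ x), hmemU x⟩ : Density (n := n) U) := by
    refine Subtype.ext (LinearMap.ext fun h => ?_)
    rw [AddSubmonoidClass.coe_finsetSum, LinearMap.sum_apply]
    simp only [LinearMap.comp_apply]
    rw [← map_sum, ← sub_eq_zero, ← map_sub]
    refine h0 _ ?_
    have : interior K' ∈ 𝓝ˢ K := isOpen_interior.mem_nhdsSet.2 hKK'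
    filter_upwards [this] with z hz
    have h1 : ∑ x : t, p x z = 1 := by
      rw [← finsum_eq_sum_of_fintype]
      exact p.sum_eq_one (interior_subset hz)
    have h2 : (h - ∑ x : t, mulFn (χ x) h).1 z = h.1 z - ∑ x : t, (p x z : ℂ) * h.1 z := by
      simp [mulFn, hχ, SmoothFn.ofReal]
    rw [h2, ← Finset.sum_mul, ← Complex.ofReal_sum, h1]
    simp
  rw [hsum, map_sum]
  exact Finset.sum_eq_zero fun x _ => hfV x (htK x x.2) _ (hmem x)

/-- A density supported in a coordinate domain is given by a test function. -/
theorem exists_eq_ofChartAux {e} (he : e ∈ Charts n M) {V : Opens M} (hVe : (V : Set M) ⊆ e.source)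
    {ρ : SmoothFn n M →ₗ[ℂ] ℂ} (hρ : ρ ∈ Density V) :
    ∃ ψ : 𝓓(chartDomain e V, ℂ), ρ = ofChartAux he ψ := by
  obtain ⟨_, _⟩ := sigmaCompact_of_charted n M
  obtain ⟨⟨K, hK, hKV, h0⟩, hw⟩ := hρ
  obtain ⟨w, hwc, hw⟩ := hw e he
  obtain ⟨K', hK', hKK', hK'V⟩ := exists_compact_between hK V.isOpen hKV
  -- The local formula for `ρ` applies only to functions compactly supported in the chart. Since `ρ
  -- h = ρ (χ h)` for a cutoff `χ` equal to 1 near `K`, the test function is `w χ`, extended by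
  -- zero.
  obtain ⟨c, hc1, hc0, -⟩ := exists_contMDiffMap_one_nhds_of_subset_interior (𝓡 n) (n := ⊤)
    hK.isClosed hKK'
  set χ : SmoothFn n M := SmoothFn.ofReal c with hχ
  have hχs : tsupport χ.1 ⊆ K' := closure_minimal (fun z hz => by
    by_contra h
    exact hz (by simp [hχ, SmoothFn.ofReal, hc0 z h])) hK'.isClosed
  have hχc : HasCompactSupport χ.1 := hK'.of_isClosed_subset (isClosed_tsupport _) hχs
  obtain ⟨hT, hTt⟩ := isCompact_image_tsupport hχc (hχs.trans (hK'V.trans hVe))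
  have hψ0 : ∀ y ∈ e.target, y ∉ e '' tsupport χ.1 → w y * χ.1 (e.symm y) = 0 :=
    fun y hy hy' => by simp [comp_symm_eq_zero χ y hy hy']
  have hsub : tsupport (e.target.indicator fun y => w y * χ.1 (e.symm y)) ⊆ e '' tsupport χ.1 := by
    refine closure_minimal (fun y hy => ?_) hT.isClosed
    by_contra hy'
    refine hy ?_
    by_cases hyt : y ∈ e.target
    · simp only [Set.indicator_of_mem hyt, hψ0 y hyt hy']
    · simp [hyt]
  refine ⟨⟨e.target.indicator fun y => w y * χ.1 (e.symm y),
    contDiff_indicator e.open_target hT.isClosed hTt (hwc.mul (contDiffOn_comp_symm χ he)) hψ0,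
    hT.of_isClosed_subset (isClosed_tsupport _) hsub, hsub.trans ?_⟩, LinearMap.ext fun h => ?_⟩
  · rintro _ ⟨x, hx, rfl⟩
    have hxV : x ∈ V := hK'V (hχs hx)
    refine ⟨e.map_source (hVe hxV), ?_⟩
    rw [Set.mem_preimage, e.left_inv (hVe hxV)]
    exact hxV
  · have h1 : ρ h = ρ (mulFn χ h) := by
      rw [← sub_eq_zero, ← map_sub]
      refine h0 _ ?_
      filter_upwards [hc1] with z hz
      change h.1 z - χ.1 z * h.1 z = 0
      simp [hχ, SmoothFn.ofReal, hz]
    have hs : tsupport (mulFn χ h).1 ⊆ tsupport χ.1 := tsupport_mul_subset_left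
    rw [h1, hw _ (hχc.of_isClosed_subset (isClosed_tsupport _) hs)
      (hs.trans (hχs.trans (hK'V.trans hVe)))]
    refine setIntegral_congr_fun e.open_target.measurableSet fun y hy => ?_
    change w y * (χ.1 (e.symm y) * h.1 (e.symm y)) =
      (e.target.indicator fun y => w y * χ.1 (e.symm y)) y * h.1 (e.symm y)
    rw [Set.indicator_of_mem hy, mul_assoc]

end Localization

/-! ### Generalized functions and transposed operators in a coordinate domain -/

section ChartFunctional

variable {n : ℕ} {M : Type*} [TopologicalSpace M] [ChartedSpace (EuclideanSpace ℝ (Fin n)) M]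
  [T2Space M]

/-- The topology on densities is an infimum of topologies, each of which makes this map continuous;
a map into an infimum is continuous as soon as it is so for each member. -/
theorem continuous_ofChart (U : Opens M) {e} (he : e ∈ Charts n M) :
    Continuous (ofChart U he) :=
  continuous_sInf_rng.2 fun _ ht => ht.1 e he

/-- The distribution on a compact subset of a coordinate domain given by a generalized function. -/
noncomputable def chartFunctional {U : Opens M} (f : GeneralizedFunction (n := n) U) {e}
    (he : e ∈ Charts n M) {K : Compacts (EuclideanSpace ℝ (Fin n))}
    (hK : (K : Set (EuclideanSpace ℝ (Fin n))) ⊆ chartDomain e U) :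
    𝓓_{K}(EuclideanSpace ℝ (Fin n), ℂ) →L[ℂ] ℂ where
  toFun ψ := f (ofChart U he (TestFunction.ofSupportedIn hK ψ))
  map_add' ψ ψ' := by
    rw [← map_add]
    congr 1
    refine Subtype.ext (LinearMap.ext fun h => ?_)
    refine Eq.trans ?_ (integral_add (integrableOn_testFunction_mul he _ h)
      (integrableOn_testFunction_mul he _ h))
    refine integral_congr_ae (Filter.Eventually.of_forall fun y => ?_)
    exact add_mul _ _ _
  map_smul' c ψ := by
    rw [RingHom.id_apply, ← map_smul]
    congr 1
    refine Subtype.ext (LinearMap.ext fun h => ?_)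
    refine Eq.trans ?_ (integral_const_mul c _)
    refine integral_congr_ae (Filter.Eventually.of_forall fun y => ?_)
    exact mul_assoc _ _ _
  cont := f.continuous.comp ((continuous_ofChart U he).comp
    (TestFunction.continuous_ofSupportedIn hK))

theorem chartFunctional_apply {U : Opens M} (f : GeneralizedFunction (n := n) U) {e}
    (he : e ∈ Charts n M) {K : Compacts (EuclideanSpace ℝ (Fin n))}
    (hK : (K : Set (EuclideanSpace ℝ (Fin n))) ⊆ chartDomain e U)
    (ψ : 𝓓_{K}(EuclideanSpace ℝ (Fin n), ℂ)) :
    chartFunctional f he hK ψ = f (ofChart U he (TestFunction.ofSupportedIn hK ψ)) := rfl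

/-- The image of the support of `ψ` is a compact set carrying the density, and each of its points
has a neighbourhood where `f` vanishes, so locality applies. -/
theorem chartFunctional_eq_zero [IsManifold (𝓡 n) ∞ M] [SecondCountableTopology M] {U : Opens M}
    (f : GeneralizedFunction (n := n) U) {e} (he : e ∈ Charts n M)
    {K : Compacts (EuclideanSpace ℝ (Fin n))}
    (hK : (K : Set (EuclideanSpace ℝ (Fin n))) ⊆ chartDomain e U)
    (ψ : 𝓓_{K}(EuclideanSpace ℝ (Fin n), ℂ)) (hψ : ∀ y ∈ tsupport ψ, e.symm y ∉ support f) :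
    chartFunctional f he hK ψ = 0 := by
  have hsub : tsupport ψ ⊆ chartDomain e U := ψ.tsupport_subset.trans hK
  have hKc : IsCompact (e.symm '' tsupport ψ) :=
    ψ.hasCompactSupport.isCompact.image_of_continuousOn
      (e.continuousOn_symm.mono fun y hy => (hsub hy).1)
  refine apply_eq_zero_of_locally_eq_zero f _ hKc (fun h hh => ?_) ?_
  · refine (setIntegral_congr_fun (g := fun _ => (0 : ℂ)) e.open_target.measurableSet
      fun y _ => ?_).trans (by simp)
    change ψ y * h.1 (e.symm y) = 0
    by_cases hy : y ∈ tsupport ψ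
    · rw [hh.self_of_nhdsSet _ (Set.mem_image_of_mem _ hy), mul_zero]
    · rw [image_eq_zero_of_notMem_tsupport hy, zero_mul]
  · rintro _ ⟨y, hy, rfl⟩
    have h1 := hψ y hy
    simp only [support, Set.mem_ofPred_eq, not_and, not_forall, not_exists, not_not] at h1
    obtain ⟨V, hV, hVU, H⟩ := h1 (hsub hy).2
    exact ⟨V, hV, hVU, H⟩

/-- The transpose of a differential operator in local coordinates. -/
theorem transpose_ofChart [IsManifold (𝓡 n) ∞ M] {k : ℕ} (D : DiffOp n M k) (U : Opens M) {e}
    (he : e ∈ Charts n M) {a} (ha : IsLocalExpression k D.1 e a)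
    {K : Compacts (EuclideanSpace ℝ (Fin n))}
    (hK : (K : Set (EuclideanSpace ℝ (Fin n))) ⊆ chartDomain e U)
    (haK : ∀ j s, ∀ y ∈ K, ContDiffAt ℝ ∞ (a j s) y) (ψ : 𝓓_{K}(EuclideanSpace ℝ (Fin n), ℂ)) :
    transpose D U (ofChart U he (TestFunction.ofSupportedIn hK ψ)) =
      ofChart U he (TestFunction.ofSupportedIn hK (∑ j ∈ Finset.range (k + 1),
        ∑ s : Fin j → Fin n, transposeDeriv j (fun i => EuclideanSpace.single (s i) (1 : ℝ))
          (smoothMul (haK j s) ψ))) := by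
  have hKt : (K : Set (EuclideanSpace ℝ (Fin n))) ⊆ e.target := hK.trans Set.inter_subset_left
  refine Subtype.ext (LinearMap.ext fun h => ?_)
  change ∫ y in e.target, ψ y * (D.1 h).1 (e.symm y) = ∫ y in e.target, (∑ j ∈ Finset.range (k + 1),
        ∑ s : Fin j → Fin n, transposeDeriv j (fun i => EuclideanSpace.single (s i) (1 : ℝ))
          (smoothMul (haK j s) ψ)) y * h.1 (e.symm y)
  have hh := contDiffOn_comp_symm h he
  have hint : ∀ (χ : 𝓓_{K}(EuclideanSpace ℝ (Fin n), ℂ)) {w : EuclideanSpace ℝ (Fin n) → ℂ},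
      ContinuousOn w e.target → IntegrableOn (fun y => χ y * w y) e.target := fun χ w hw =>
    integrableOn_of_zero_off e.open_target K.isCompact hKt (χ.continuous.continuousOn.mul hw)
      fun y _ hy => by simp [χ.zero_on_compl hy]
  have e1 : ∀ y ∈ e.target, ψ y * (D.1 h).1 (e.symm y) =
      ∑ j ∈ Finset.range (k + 1), ∑ s : Fin j → Fin n, smoothMul (haK j s) ψ y *
        iteratedFDeriv ℝ j (fun y => h.1 (e.symm y)) y
          (fun i => EuclideanSpace.single (s i) (1 : ℝ)) := by
    intro y hy
    rw [ha.2 h y hy]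
    simp only [Finset.mul_sum, smoothMul_apply]
    refine Finset.sum_congr rfl fun j _ => Finset.sum_congr rfl fun s _ => ?_
    ring
  have e2 : ∀ y ∈ e.target, (∑ j ∈ Finset.range (k + 1),
        ∑ s : Fin j → Fin n, transposeDeriv j (fun i => EuclideanSpace.single (s i) (1 : ℝ))
          (smoothMul (haK j s) ψ)) y * h.1 (e.symm y) =
      ∑ j ∈ Finset.range (k + 1),
        ∑ s : Fin j → Fin n, transposeDeriv j (fun i => EuclideanSpace.single (s i) (1 : ℝ))
          (smoothMul (haK j s) ψ) y * h.1 (e.symm y) := by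
    intro y _
    simp [Finset.sum_mul]
  rw [setIntegral_congr_fun e.open_target.measurableSet e1,
    setIntegral_congr_fun e.open_target.measurableSet e2]
  have i1 : ∀ (j : ℕ) (s : Fin j → Fin n), IntegrableOn (fun y => smoothMul (haK j s) ψ y *
        iteratedFDeriv ℝ j (fun y => h.1 (e.symm y)) y
          (fun i => EuclideanSpace.single (s i) (1 : ℝ))) e.target := fun j s =>
    hint _ (contDiffOn_iteratedFDeriv_apply e.open_target hh j _).continuousOn
  have i2 : ∀ (j : ℕ) (s : Fin j → Fin n), IntegrableOn (fun y =>
      transposeDeriv j (fun i => EuclideanSpace.single (s i) (1 : ℝ))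
          (smoothMul (haK j s) ψ) y * h.1 (e.symm y)) e.target := fun j s =>
    hint _ hh.continuousOn
  rw [integral_finsetSum _ fun j _ => integrable_finsetSum _ fun s _ => i1 j s,
    integral_finsetSum _ fun j _ => integrable_finsetSum _ fun s _ => i2 j s]
  refine Finset.sum_congr rfl fun j _ => ?_
  rw [integral_finsetSum _ fun s _ => i1 j s, integral_finsetSum _ fun s _ => i2 j s]
  exact Finset.sum_congr rfl fun s _ =>
    integral_mul_iteratedFDeriv e.open_target hKt hh j _ _

end ChartFunctional

/-! ### The symbol on the conormal space -/

/-- A symmetric nondegenerate bilinear form takes a nonzero value `B w w` on the orthogonal of a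
proper nondegenerate subspace. -/
theorem exists_orthogonal_apply_self_ne_zero {V : Type*} [AddCommGroup V] [Module ℝ V]
    [FiniteDimensional ℝ V] (B : LinearMap.BilinForm ℝ V) (hB : ∀ v w, B v w = B w v)
    (hnd : ∀ v, (∀ w, B v w = 0) → v = 0) {N : Submodule ℝ V} (hN : N ≠ ⊤)
    (hNnd : ∀ v ∈ N, (∀ w ∈ N, B v w = 0) → v = 0) :
    ∃ w, (∀ v ∈ N, B w v = 0) ∧ B w w ≠ 0 := by
  have hrefl : B.IsRefl := fun v w h => by rw [hB, h]
  have hcompl : IsCompl N (B.orthogonal N) := by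
    rw [LinearMap.BilinForm.isCompl_orthogonal_iff_disjoint hrefl, Submodule.disjoint_def]
    exact fun v hv hv' => hNnd v hv fun w hw => (hB v w).trans (hv' w hw)
  -- If `B w w` vanished on the whole orthogonal of `N`, polarization would make `B` zero there. The
  -- orthogonal would then be orthogonal to all of `V = N ⊕ N^⊥`, hence zero, forcing `N = ⊤`.
  by_contra! H
  have hP : ∀ v ∈ B.orthogonal N, ∀ w ∈ N, B v w = 0 := fun v hv w hw => (hB v w).trans (hv w hw)
  have hP0 : ∀ v ∈ B.orthogonal N, B v v = 0 := fun v hv => H v (hP v hv)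
  refine hN ?_
  have hbot : B.orthogonal N = ⊥ := by
    rw [Submodule.eq_bot_iff]
    refine fun v hv => hnd v fun w => ?_
    obtain ⟨a, ha, b, hb, rfl⟩ := Submodule.mem_sup.1
      (hcompl.sup_eq_top ▸ Submodule.mem_top : w ∈ N ⊔ B.orthogonal N)
    have h1 := hP0 (v + b) (Submodule.add_mem _ hv hb)
    simp only [map_add, LinearMap.add_apply, hP0 v hv, hP0 b hb, hB b v] at h1
    rw [map_add, hP v hv a ha]
    linarith
  have := hcompl.sup_eq_top
  rwa [hbot, sup_bot_eq] at this

/-- The coordinates of `w` in the basis `v` are the numbers `B w (u i)`. This computes a symbol of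
Laplacian type at the covector `B w`. -/
theorem sum_apply_mul_apply_dual {ι V : Type*} [Fintype ι] [DecidableEq ι] [AddCommGroup V]
    [Module ℝ V] (B : LinearMap.BilinForm ℝ V) (hB : ∀ v w, B v w = B w v)
    (u v : Module.Basis ι ℝ V) (huv : ∀ i j, B (u i) (v j) = if i = j then 1 else 0) (w : V) :
    ∑ i, B w (u i) * B w (v i) = B w w := by
  have h : ∀ i, v.repr w i = B w (u i) := by
    intro i
    conv_rhs => rw [hB, ← v.sum_repr w, map_sum]
    simp [huv]
  calc ∑ i, B w (u i) * B w (v i) = B w (∑ i, v.repr w i • v i) := by simp [h]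
    _ = B w w := by rw [v.sum_repr]

/-! ### Noncharacteristic covectors along the submanifold -/

section Manifold

variable {n : ℕ} {M : Type*} [TopologicalSpace M] [ChartedSpace (EuclideanSpace ℝ (Fin n)) M]

/-- Evaluation of the symmetric algebra at a real covector. -/
noncomputable def evalSym {x : M} (l : TangentSpace (𝓡 n) x →ₗ[ℝ] ℝ) :
    SymmetricAlgebra ℂ (ℂ ⊗[ℝ] TangentSpace (𝓡 n) x) →ₐ[ℂ] ℂ :=
  SymmetricAlgebra.lift (TensorProduct.AlgebraTensorModule.lift
    ((LinearMap.toSpanSingleton ℂ (TangentSpace (𝓡 n) x →ₗ[ℝ] ℂ)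
      (Complex.ofRealCLM.toLinearMap ∘ₗ l))))

theorem evalSym_toSym {x : M} (l : TangentSpace (𝓡 n) x →ₗ[ℝ] ℝ) (v : TangentSpace (𝓡 n) x) :
    evalSym l (toSym v) = (l v : ℂ) := by
  simp [evalSym, toSym]

/-- The vector is the velocity of the curve whose coordinate expression is the straight line from `e
z` in the direction `w`; this line stays in the affine subspace representing `Z`. -/
theorem mem_tangentSubspace_of_chart {Z : Set M} {z : M} {e} (he : e ∈ Charts n M)
    (hz : z ∈ e.source) {W : Submodule ℝ (EuclideanSpace ℝ (Fin n))}
    (hW : ∀ x ∈ e.source, x ∈ Z ↔ e x - e z ∈ W) {w : EuclideanSpace ℝ (Fin n)} (hw : w ∈ W) :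
    (mfderiv (𝓡 n) (𝓡 n) e.symm (e z) w : EuclideanSpace ℝ (Fin n)) ∈ tangentSubspace n Z z := by
  set c : ℝ → EuclideanSpace ℝ (Fin n) := fun t => e z + t • w with hc
  have hc0 : c 0 = e z := by simp [hc]
  have hct : ContDiff ℝ ∞ c := contDiff_const.add (contDiff_id.smul contDiff_const)
  have hct0 : c 0 ∈ e.target := hc0 ▸ e.map_source hz
  have hes : ContMDiffAt (𝓡 n) (𝓡 n) ∞ e.symm (c 0) :=
    (contMDiffOn_symm_of_mem_maximalAtlas he).contMDiffAt (e.open_target.mem_nhds hct0)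
  refine Submodule.subset_span ⟨e.symm ∘ c, ?_, ?_, hes.comp 0 hct.contMDiff.contMDiffAt, ?_⟩
  · simp [hc0, e.left_inv hz]
  · filter_upwards [hct.continuous.continuousAt.preimage_mem_nhds (e.open_target.mem_nhds hct0)]
      with t ht
    refine (hW _ (e.map_target ht)).2 ?_
    rw [e.right_inv ht]
    simpa [hc] using W.smul_mem t hw
  · have h1 : HasFDerivAt c (ContinuousLinearMap.toSpanSingleton ℝ w) 0 := by
      have := (((hasDerivAt_id (0 : ℝ)).smul_const w).const_add (e z)).hasFDerivAt
      rwa [one_smul] at this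
    have h2 : HasMFDerivAt 𝓘(ℝ, ℝ) (𝓡 n) c 0 (ContinuousLinearMap.toSpanSingleton ℝ w) :=
      h1.hasMFDerivAt
    have h3 := ((hes.mdifferentiableAt (by simp)).hasMFDerivAt.comp 0 h2).mfderiv
    have h4 : (mfderiv (𝓡 n) (𝓡 n) e.symm (c 0) w : EuclideanSpace ℝ (Fin n)) =
        mfderiv (𝓡 n) (𝓡 n) e.symm (e z) w :=
      congrArg (fun y => (mfderiv (𝓡 n) (𝓡 n) e.symm y w : EuclideanSpace ℝ (Fin n))) hc0
    refine Eq.trans ?_ h4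
    rw [h3]
    change mfderiv (𝓡 n) (𝓡 n) e.symm (c 0) ((1 : ℝ) • w) = _
    rw [one_smul]

/-- The action of the transpose of a second order operator on multiples of powers of an affine
function. -/
theorem exists_transpose_powMul {K : Compacts (EuclideanSpace ℝ (Fin n))}
    {a : (j : ℕ) → (Fin j → Fin n) → EuclideanSpace ℝ (Fin n) → ℂ}
    (ha : ∀ j s, ∀ y ∈ K, ContDiffAt ℝ ∞ (a j s) y) (ℓ : EuclideanSpace ℝ (Fin n) →L[ℝ] ℝ)
    (y₀ : EuclideanSpace ℝ (Fin n)) {q : EuclideanSpace ℝ (Fin n) → ℂ}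
    (hq : ∀ y ∈ K, ContDiffAt ℝ ∞ q y)
    (hqa : ∀ y, q y = ∑ s : Fin 2 → Fin n, a 2 s y *
      ∏ i, (ℓ (EuclideanSpace.single (s i) (1 : ℝ)) : ℂ))
    (m : ℕ) (χ : 𝓓_{K}(EuclideanSpace ℝ (Fin n), ℂ)) :
    ∃ χ', ∑ j ∈ Finset.range (2 + 1), ∑ s : Fin j → Fin n,
        transposeDeriv j (fun i => EuclideanSpace.single (s i) (1 : ℝ))
          (smoothMul (ha j s) (powMul ℓ y₀ (m + 2) χ)) =
      powMul ℓ y₀ (m + 1) χ' + powMul ℓ y₀ m (((m + 2) * (m + 1) : ℂ) • smoothMul hq χ) := by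
  choose χ₀ h₀ using fun s : Fin 0 → Fin n => exists_transposeDeriv_powMul ℓ y₀ m zero_le_one
    (fun i => EuclideanSpace.single (s i) (1 : ℝ)) (smoothMul (ha 0 s) χ)
  choose χ₁ h₁ using fun s : Fin 1 → Fin n => exists_transposeDeriv_powMul ℓ y₀ m le_rfl
    (fun i => EuclideanSpace.single (s i) (1 : ℝ)) (smoothMul (ha 1 s) χ)
  choose χ₂ h₂ using fun s : Fin 2 → Fin n => exists_transposeDeriv_two_powMul ℓ y₀ m
    (fun i => EuclideanSpace.single (s i) (1 : ℝ)) (smoothMul (ha 2 s) χ)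
  refine ⟨∑ s, χ₀ s + ∑ s, χ₁ s + ∑ s, χ₂ s, ?_⟩
  -- The coefficients of the operator commute with the powers, so each order is covered by one of
  -- the preceding expansions; only order 2 yields a term with `m` powers.
  simp only [Finset.sum_range_succ, Finset.sum_range_zero, zero_add, smoothMul_powMul, h₀, h₁, h₂,
    Finset.sum_add_distrib, map_add, map_sum, add_assoc]
  congr 3
  rw [← map_sum]
  congr 1
  ext y
  simp only [FunLike.coe_sum, Finset.sum_apply, FunLike.coe_smul, Pi.smul_apply, smoothMul_apply,
    smul_eq_mul, hqa, Fin.prod_univ_two, Finset.sum_mul, Finset.mul_sum]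
  exact Finset.sum_congr rfl fun s _ => by ring

variable [IsManifold (𝓡 n) ∞ M]

/-- Around each point of a metrically proper submanifold, there is an affine function in local
coordinates that vanishes on the submanifold and whose zero set is noncharacteristic. -/
theorem PseudoRiemannianMetric.exists_noncharacteristic (g : PseudoRiemannianMetric n M) {Z : Set M}
    (hZg : g.IsMetricallyProper Z) {D : DiffOp n M 2} (hD : g.IsLaplacianType D) {z : M}
    (hzZ : z ∈ Z) {e} (he : e ∈ Charts n M) (hz : z ∈ e.source)
    {W : Submodule ℝ (EuclideanSpace ℝ (Fin n))} (hW : ∀ x ∈ e.source, x ∈ Z ↔ e x - e z ∈ W)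
    {a} (ha : IsLocalExpression 2 D.1 e a) :
    ∃ ℓ : EuclideanSpace ℝ (Fin n) →L[ℝ] ℝ, (∀ w ∈ W, ℓ w = 0) ∧
      ∑ s : Fin 2 → Fin n, a 2 s (e z) *
        ∏ i, (ℓ (EuclideanSpace.single (s i) (1 : ℝ)) : ℂ) ≠ 0 := by
  obtain ⟨N, hZN, hN, hNnd⟩ := hZg z hzZ
  set B : LinearMap.BilinForm ℝ (TangentSpace (𝓡 n) z) :=
    LinearMap.mk₂ ℝ (fun v w => g.form z v w) (by simp) (by simp) (by simp) (by simp)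
  have : FiniteDimensional ℝ (TangentSpace (𝓡 n) z) :=
    inferInstanceAs (FiniteDimensional ℝ (EuclideanSpace ℝ (Fin n)))
  obtain ⟨w, hwN, hww⟩ := exists_orthogonal_apply_self_ne_zero B (g.symm z) (g.nondegenerate z) hN
    hNnd
  obtain ⟨u, v, huv, hσ⟩ := hD z
  -- Both expressions of the symbol are evaluated at `B w`: the dual bases give `B w w`, the
  -- coordinate expression gives the sum in the goal.
  have hσ := congrArg (evalSym (B w)) (hσ e he hz a ha)
  simp only [map_sum, map_mul, map_smul, map_prod, evalSym_toSym, smul_eq_mul] at hσ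
  have hsum : ∑ i, ((B w (u i) : ℝ) : ℂ) * ((B w (v i) : ℝ) : ℂ) = (B w w : ℝ) := by
    rw [← sum_apply_mul_apply_dual B (g.symm z) u v huv w]
    push_cast
    rfl
  rw [hsum] at hσ
  let A : EuclideanSpace ℝ (Fin n) →L[ℝ] EuclideanSpace ℝ (Fin n) :=
    mfderiv (𝓡 n) (𝓡 n) e.symm (e z)
  let b : EuclideanSpace ℝ (Fin n) →L[ℝ] ℝ := g.form z w
  -- `ℓ` is `B w` pulled back by the derivative of `e.symm`, so its values on the standard basis are
  -- those of `B w` on the coordinate vectors.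
  refine ⟨b ∘L A, fun y hy => hwN _ (hZN (mem_tangentSubspace_of_chart he hz hW hy)), ?_⟩
  intro h0
  refine hww ?_
  rw [← Complex.ofReal_eq_zero, hσ]
  exact h0

/-! ### Local vanishing at points of the submanifold -/

variable [T2Space M] [SecondCountableTopology M]

/-- A solution of `D f = 0` that is supported in a metrically proper submanifold vanishes near each
point of the submanifold. -/
theorem PseudoRiemannianMetric.exists_nhds_eq_zero (g : PseudoRiemannianMetric n M) {Z : Set M}
    (hZ : IsSubmanifold n Z) (hZg : g.IsMetricallyProper Z) {D : DiffOp n M 2}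
    (hD : g.IsLaplacianType D) {U : Opens M} {f : GeneralizedFunction (n := n) U}
    (hf : support f ⊆ Z) (hDf : applyGen D f = 0) {z : M} (hzZ : z ∈ Z) (hzU : z ∈ U) :
    ∃ V : Opens M, z ∈ V ∧ V ≤ U ∧
      ∀ τ : Density (n := n) U, τ.1 ∈ Density (n := n) V → f τ = 0 := by
  obtain ⟨e, he, hz, W, hW⟩ := hZ z hzZ
  obtain ⟨a, ha⟩ := D.2 e he
  obtain ⟨ℓ, hℓW, hℓ⟩ := g.exists_noncharacteristic hZg hD hzZ he hz hW ha
  set q : EuclideanSpace ℝ (Fin n) → ℂ := fun y => ∑ s : Fin 2 → Fin n, a 2 s y *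
    ∏ i, (ℓ (EuclideanSpace.single (s i) (1 : ℝ)) : ℂ) with hqdef
  have hat : ∀ j s, ∀ y ∈ e.target, ContDiffAt ℝ ∞ (a j s) y :=
    fun j s y hy => (ha.1 j s).contDiffAt (e.open_target.mem_nhds hy)
  have hqt : ∀ y ∈ e.target, ContDiffAt ℝ ∞ q y := fun y hy =>
    ContDiffAt.sum fun s _ => (hat 2 s y hy).mul contDiffAt_const
  have hezU : e z ∈ chartDomain e U := ⟨e.map_source hz, by
    rw [Set.mem_preimage, e.left_inv hz]
    exact hzU⟩
  -- The symbol is known to be nonzero only at `z`; continuity of the coefficients extends this to a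
  -- compact ball.
  obtain ⟨r, hr, hrK⟩ := Metric.nhds_basis_closedBall.mem_iff.1 (Filter.inter_mem
    ((chartDomain e U).isOpen.mem_nhds hezU)
    ((hqt _ hezU.1).continuousAt.eventually_ne hℓ))
  set K : Compacts (EuclideanSpace ℝ (Fin n)) :=
    ⟨Metric.closedBall (e z) r, isCompact_closedBall _ _⟩
  have hK : (K : Set (EuclideanSpace ℝ (Fin n))) ⊆ chartDomain e U := fun y hy => (hrK hy).1
  have hFχ : ∀ χ, chartFunctional f he hK χ = 0 := by
    -- In the chart, `Z` lies in the zero set of `ℓ (· - e z)`, so test functions supported off that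
    -- set avoid the support of `f`.
    obtain ⟨m, hm⟩ := exists_powMul_eq_zero (chartFunctional f he hK) ℓ (e z) fun χ hχ => by
      refine chartFunctional_eq_zero f he hK χ fun y hy hy' => hχ y hy (hℓW _ ?_)
      have hyt : y ∈ e.target := (hK (χ.tsupport_subset hy)).1
      have := (hW _ (e.map_target hyt)).1 (hf hy')
      rwa [e.right_inv hyt] at this
    refine eq_zero_of_powMul_eq_zero (F := (chartFunctional f he hK).toLinearMap) ℓ (e z)
      (L := fun χ => ∑ j ∈ Finset.range (2 + 1), ∑ s : Fin j → Fin n,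
        transposeDeriv j (fun i => EuclideanSpace.single (s i) (1 : ℝ))
          (smoothMul (fun y hy => hat j s y (hK hy).1) χ)) (q := q) (fun χ => ?_) (fun y hy => hqt y (hK hy).1) (fun y hy => (hrK hy).2)
      (exists_transpose_powMul (fun j s y hy => hat j s y (hK hy).1) ℓ (e z) _ fun _ => rfl) m hm
    change chartFunctional f he hK _ = 0
    rw [chartFunctional_apply, ← transpose_ofChart D U he ha hK]
    exact LinearMap.congr_fun hDf _
  refine ⟨⟨e.source ∩ e ⁻¹' Metric.ball (e z) r,
    e.isOpen_inter_preimage Metric.isOpen_ball⟩, ⟨hz, Metric.mem_ball_self hr⟩, fun x hx => ?_,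
    fun τ hτ => ?_⟩
  · have := (hK (Metric.ball_subset_closedBall hx.2)).2
    rwa [Set.mem_preimage, e.left_inv hx.1] at this
  · obtain ⟨ψ, hψ⟩ := exists_eq_ofChartAux he Set.inter_subset_left hτ
    have hψK : Function.support ψ ⊆ K := fun y hy => by
      have h1 := ψ.tsupport_subset (subset_tsupport _ hy)
      have h2 : e (e.symm y) ∈ Metric.ball (e z) r := h1.2.2
      rw [e.right_inv h1.1] at h2
      exact Metric.ball_subset_closedBall h2
    rw [← hFχ (ContDiffMapSupportedIn.of_support_subset ψ.contDiff hψK), chartFunctional_apply]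
    exact congrArg f (Subtype.ext hψ)

end Manifold

end GenFun

theorem proposition2p1 {n : ℕ} {M : Type*} [TopologicalSpace M]
    [ChartedSpace (EuclideanSpace ℝ (Fin n)) M] [IsManifold (𝓡 n) ∞ M]
    [T2Space M] [SecondCountableTopology M]
    (g : GenFun.PseudoRiemannianMetric n M)
    (Z : Set M) (hZ : GenFun.IsSubmanifold n Z) (hZg : g.IsMetricallyProper Z)
    (D : GenFun.DiffOp n M 2) (hD : g.IsLaplacianType D)
    (U : Opens M) (hZU : Z ⊆ U) (hZcl : IsClosed ((↑) ⁻¹' Z : Set U))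
    (f : GenFun.GeneralizedFunction (n := n) U)
    (hf : GenFun.support f ⊆ Z) (hDf : GenFun.applyGen D f = 0) :
    f = 0 := by
  ext ρ
  obtain ⟨K, hK, hKU, h0⟩ := ρ.2.1
  refine GenFun.apply_eq_zero_of_locally_eq_zero f ρ hK h0 fun x hx => ?_
  -- Points of `Z` are handled by the noncharacteristic argument; the others lie outside the support
  -- of `f`, where local vanishing is the definition.
  by_cases hxZ : x ∈ Z
  · exact g.exists_nhds_eq_zero hZ hZg hD hf hDf hxZ (hKU hx)
  · have hxs : x ∉ GenFun.support f := fun h => hxZ (hf h)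
    simp only [GenFun.support, Set.mem_ofPred_eq, not_and, not_forall, not_exists, not_not] at hxs
    obtain ⟨V, hV, hVU, H⟩ := hxs (hKU hx)
    exact ⟨V, hV, hVU, H⟩
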